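/- Let $X$ be a scheme and $\mathcal M$ a quasi-coherent sheaf on $X$. Write $X/\mathrm{Sch}$ for the category of schemes under $X$. For a closed immersion $f:X\to Y$ put $\mathcal I_f=\ker(f^\#:\mathcal O_Y\to f_*\mathcal O_X)$; for $x\in X$ let $f^\#_x:\mathcal O_{Y,f(x)}\to\mathcal O_{X,x}$ be the induced map and identify $(f_*\mathcal M)_{f(x)}=\mathcal M_x$ and $(f_*\mathcal O_X)_{f(x)}=\mathcal O_{X,x}$. For a morphism $h:Y\to Z$ in $X/\mathrm{Sch}$ from $f:X\to Y$ to $g:X\to Z$ and $x\in X$, write $h^\#_x:\mathcal O_{Z,g(x)}\to\mathcal O_{Y,f(x)}$ for the induced map. *Rings.* Let $A$ be a ring, $M$ an $A$-module and $A\oplus M$ the ring with $(a_1,m_1)(a_2,m_2)=(a_1a_2,a_1m_2+a_2m_1)$. A *square-zero extension* of $A$ by $M$ is a surjective ring homomorphism $f:B\to A$ with $(\ker f)^2=0$ together with an isomorphism of $B$-modules $\alpha:M\to\ker f$ ($B$ acting on $M$ through $f$). An *$M$-torsor* over $A$ is a surjective ring homomorphism $f:B\to A$ together with a homomorphism $\tau:(A\oplus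 M)\times_A B\to B$ of rings over $A$, written $\tau(m,b)=\tau((f(b),m),b)$, such that $\tau(0,b)=b$ for all $b\in B$ and, for all $b_1,b_2\in B$ with $f(b_1)=f(b_2)$, there is a unique $m\in M$ with $\tau(m,b_2)=b_1$. *Thickenings.* A *first order thickening* of $X$ by $\mathcal M$ is a surjective closed immersion $f:X\to Y$ together with an isomorphism $\alpha_f:f_*\mathcal M\to\mathcal I_f$ of $\mathcal O_Y$-modules such that, for each $x\in X$, $f^\#_x$ together with the induced map $\alpha_{f,x}$ is a square-zero extension of $\mathcal O_{X,x}$ by $\mathcal M_x$. A morphism from $(f:X\to Y,\alpha_f)$ to $(g:X\to Z,\alpha_g)$ is a morphism $h:Y\to Z$ in $X/\mathrm{Sch}$ with $h^\#_x(\alpha_{g,x}(m))=\alpha_{f,x}(m)$ for all $x\in X$, $m\in\mathcal M_x$. This gives the category $\mathrm{ThSch}(X,\mathcal M)$. *Cotorsors.* Let $X\oplus\mathcal M$ be the scheme with underlying space $X$ and structure sheaf $\mathcal O_X\oplus\mathcal M$, and $i_X:X\to X\oplus\mathcal M$ the morphism given by the identity on spaces and the projection $\mathcal O_X\oplus\mathcal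 M\to\mathcal O_X$. For a closed immersion $f:X\to Y$, let $i_X\amalg f:X\to(X\oplus\mathcal M)\amalg_XY$ be the pushout of $i_X$ and $f$ in schemes; it has underlying space $Y$ and structure sheaf $(f_*\mathcal O_X\oplus f_*\mathcal M)\times_{f_*\mathcal O_X}\mathcal O_Y$. An *$\mathcal M$-cotorsor* is a closed immersion $f:X\to Y$ together with a morphism $\tau_f:Y\to(X\oplus\mathcal M)\amalg_XY$ in $X/\mathrm{Sch}$ (from $f$ to $i_X\amalg f$) such that $\tau_f$ is the identity on topological spaces and, for each $y\in Y$, the map $f^\#_y:\mathcal O_{Y,y}\to(f_*\mathcal O_X)_y$ together with $$\tau^\#_{f,y}:\big((f_*\mathcal O_X)_y\oplus(f_*\mathcal M)_y\big)\times_{(f_*\mathcal O_X)_y}\mathcal O_{Y,y}\to\mathcal O_{Y,y}$$ is an $(f_*\mathcal M)_y$-torsor over $(f_*\mathcal O_X)_y$. For $x\in X$, $m\in\mathcal M_x$ and $b\in\mathcal O_{Y,f(x)}$ write $\tau_{f,x}(m,b)\in\mathcal O_{Y,f(x)}$ for the value of $\tau^\#_{f,f(x)}$. A morphism from $(f:X\to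 Y,\tau_f)$ to $(g:X\to Z,\tau_g)$ is a morphism $h:Y\to Z$ in $X/\mathrm{Sch}$ with $h^\#_x(\tau_{g,x}(m,c))=\tau_{f,x}(m,h^\#_x(c))$ for all $x\in X$, $m\in\mathcal M_x$, $c\in\mathcal O_{Z,g(x)}$. This gives the category $\mathcal M\text{-}\mathrm{coTors}$. *The functor.* Let $\Phi:\mathrm{ThSch}(X,\mathcal M)\to\mathcal M\text{-}\mathrm{coTors}$ be the functor which sends $(f,\alpha_f)$ to $(f,\tau_f)$, where $\tau_f$ is the morphism in $X/\mathrm{Sch}$ that is the identity on topological spaces and satisfies $\tau_{f,x}(m,b)=\alpha_{f,x}(m)+b$ for all $x\in X$, $m\in\mathcal M_x$, $b\in\mathcal O_{Y,f(x)}$, and which sends each morphism $h$ to $h$. **Theorem.** The functor $\Phi:\mathrm{ThSch}(X,\mathcal M)\to\mathcal M\text{-}\mathrm{coTors}$ is an equivalence of categories. -/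

import Mathlib

open CategoryTheory Opposite TopologicalSpace AlgebraicGeometry

universe u

namespace SqZeroThickening

set_option linter.unusedSectionVars false

noncomputable section

section Rings

/-- The ring `A ⊕ M`, with `(a₁, m₁) (a₂, m₂) = (a₁ a₂, a₁ m₂ + a₂ m₁)`. -/
def SqZero (A M : Type*) : Type _ := TrivSqZeroExt A M

variable {A B M : Type*} [CommRing A] [CommRing B] [AddCommGroup M] [Module A M]

namespace SqZero

def fst (x : SqZero A M) : A := TrivSqZeroExt.fst x
def snd (x : SqZero A M) : M := TrivSqZeroExt.snd x
def mk (a : A) (m : M) : SqZero A M := (a, m)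

instance : CommRing (SqZero A M) :=
  letI : Module Aᵐᵒᵖ M := Module.compHom M ((RingHom.id A).fromOpposite mul_comm)
  haveI : IsCentralScalar A M := ⟨fun _ _ => rfl⟩
  inferInstanceAs (CommRing (TrivSqZeroExt A M))

@[ext] lemma ext {x y : SqZero A M} (h₁ : x.fst = y.fst) (h₂ : x.snd = y.snd) : x = y :=
  Prod.ext h₁ h₂

@[simp] lemma fst_mk (a : A) (m : M) : (mk a m).fst = a := rfl
@[simp] lemma snd_mk (a : A) (m : M) : (mk a m).snd = m := rfl
@[simp] lemma fst_zero : (0 : SqZero A M).fst = 0 := rfl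
@[simp] lemma snd_zero : (0 : SqZero A M).snd = 0 := rfl
@[simp] lemma fst_one : (1 : SqZero A M).fst = 1 := rfl
@[simp] lemma snd_one : (1 : SqZero A M).snd = 0 := rfl
@[simp] lemma fst_add (x y : SqZero A M) : (x + y).fst = x.fst + y.fst := rfl
@[simp] lemma snd_add (x y : SqZero A M) : (x + y).snd = x.snd + y.snd := rfl
@[simp] lemma fst_mul (x y : SqZero A M) : (x * y).fst = x.fst * y.fst := rfl
@[simp] lemma snd_mul (x y : SqZero A M) : (x * y).snd = x.fst • y.snd + y.fst • x.snd := rfl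

/-- The projection `π_A : A ⊕ M → A`. -/
@[simps] def proj (A M : Type*) [CommRing A] [AddCommGroup M] [Module A M] : SqZero A M →+* A where
  toFun := fst
  map_one' := rfl
  map_mul' _ _ := rfl
  map_zero' := rfl
  map_add' _ _ := rfl

/-- The inclusion `A → A ⊕ M`. -/
@[simps] def incl (A M : Type*) [CommRing A] [AddCommGroup M] [Module A M] : A →+* SqZero A M where
  toFun a := mk a 0
  map_one' := rfl
  map_mul' _ _ := by ext <;> simp
  map_zero' := rfl
  map_add' _ _ := by ext <;> simp

/-- Functoriality of `A ⊕ M` in the pair `(A, M)`. -/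
@[simps] def map {A' M' : Type*} [CommRing A'] [AddCommGroup M'] [Module A' M'] (φ : A →+* A')
    (ψ : M →+ M') (h : ∀ a m, ψ (a • m) = φ a • ψ m) : SqZero A M →+* SqZero A' M' where
  toFun x := mk (φ x.fst) (ψ x.snd)
  map_one' := by ext <;> simp
  map_mul' _ _ := by ext <;> simp [h]
  map_zero' := by ext <;> simp
  map_add' _ _ := by ext <;> simp

end SqZero

/-- The subring `(A ⊕ M) ×_A B` of `(A ⊕ M) × B`, for `f : B → A`. -/
def fibSubring (M : Type*) [AddCommGroup M] [Module A M] (f : B →+* A) : Subring (SqZero A M × B) :=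
  ((SqZero.proj A M).comp (RingHom.fst _ B)).eqLocus (f.comp (RingHom.snd (SqZero A M) B))

/-- The ring `(A ⊕ M) ×_A B`. -/
def Fib (M : Type*) [AddCommGroup M] [Module A M] (f : B →+* A) : Type _ := fibSubring M f

namespace Fib

variable {f : B →+* A}

instance : CommRing (Fib M f) := inferInstanceAs (CommRing (fibSubring M f))

/-- The element `((f b, m), b)` of `(A ⊕ M) ×_A B`; every element is of this form. -/
def mk (f : B →+* A) (m : M) (b : B) : Fib M f := ⟨(SqZero.mk (f b) m, b), rfl⟩

/-- The projection to `A ⊕ M`. -/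
def toSqZero (f : B →+* A) : Fib M f →+* SqZero A M :=
  (RingHom.fst _ B).comp (fibSubring M f).subtype

/-- The projection to `B`. -/
def toB (f : B →+* A) : Fib M f →+* B := (RingHom.snd (SqZero A M) B).comp (fibSubring M f).subtype

/-- The component in `M`. -/
def m (p : Fib M f) : M := p.1.1.snd

/-- The component in `B`. -/
def b (p : Fib M f) : B := p.1.2

lemma fst_eq (p : Fib M f) : p.1.1.fst = f p.b := p.2

lemma ext' {p q : Fib M f} (h₁ : p.m = q.m) (h₂ : p.b = q.b) : p = q :=
  Subtype.ext (Prod.ext (SqZero.ext (by rw [fst_eq, fst_eq, h₂]) h₁) h₂)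

@[simp] lemma m_mk (m : M) (b : B) : (mk f m b).m = m := rfl
@[simp] lemma b_mk (m : M) (b : B) : (mk f m b).b = b := rfl
lemma mk_m_b (p : Fib M f) : mk f p.m p.b = p := ext' rfl rfl
@[simp] lemma m_zero : (0 : Fib M f).m = 0 := rfl
@[simp] lemma b_zero : (0 : Fib M f).b = 0 := rfl
@[simp] lemma m_one : (1 : Fib M f).m = 0 := rfl
@[simp] lemma b_one : (1 : Fib M f).b = 1 := rfl
@[simp] lemma m_add (p q : Fib M f) : (p + q).m = p.m + q.m := rfl
@[simp] lemma b_add (p q : Fib M f) : (p + q).b = p.b + q.b := rfl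
@[simp] lemma b_mul (p q : Fib M f) : (p * q).b = p.b * q.b := rfl
@[simp] lemma m_mul (p q : Fib M f) : (p * q).m = f p.b • q.m + f q.b • p.m := by
  rw [← fst_eq, ← fst_eq]; rfl

/-- The ring homomorphism `B → (A ⊕ M) ×_A B`, `b ↦ ((f b, 0), b)`. -/
def ofB (f : B →+* A) : B →+* Fib M f where
  toFun b := mk f 0 b
  map_one' := ext' rfl rfl
  map_mul' _ _ := ext' (by simp) rfl
  map_zero' := ext' rfl rfl
  map_add' _ _ := ext' (by simp) rfl

/-- Functoriality of `(A ⊕ M) ×_A B`. -/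
def map {A' B' M' : Type*} [CommRing A'] [CommRing B'] [AddCommGroup M'] [Module A' M']
    {f' : B' →+* A'} (φ : A →+* A') (ψ : M →+ M') (χ : B →+* B')
    (h : ∀ a m, ψ (a • m) = φ a • ψ m) (hf : ∀ b, f' (χ b) = φ (f b)) : Fib M f →+* Fib M' f' where
  toFun p := mk f' (ψ p.m) (χ p.b)
  map_one' := ext' (by simp) (by simp)
  map_mul' _ _ := ext' (by simp [h, hf]) (by simp)
  map_zero' := ext' (by simp) (by simp)
  map_add' _ _ := ext' (by simp) (by simp)

end Fib

/-- A ring homomorphism `f : B → A` together with a map `α : M → B` is a square-zero extension of `A`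
by `M`: `f` is surjective, its kernel has square zero, and `α` is an isomorphism of `B`-modules
from `M` (a `B`-module through `f`) to `ker f`. -/
structure IsSquareZeroExtension (f : B →+* A) (α : M →+ B) : Prop where
  surjective : Function.Surjective f
  sq_eq_bot : RingHom.ker f ^ 2 = ⊥
  map_smul : ∀ (b : B) (m : M), α (f b • m) = b * α m
  injective : Function.Injective α
  range_eq : Set.range α = RingHom.ker f

/-- A ring homomorphism `f : B → A` together with `τ : (A ⊕ M) ×_A B → B` is an `M`-torsor over `A`. -/
structure IsTorsor (f : B →+* A) (τ : Fib M f →+* B) : Prop where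
  surjective : Function.Surjective f
  map_eq : ∀ p : Fib M f, f (τ p) = f p.b
  zero_act : ∀ b : B, τ (Fib.mk f (0 : M) b) = b
  existsUnique : ∀ b₁ b₂ : B, f b₁ = f b₂ → ∃! m : M, τ (Fib.mk f m b₂) = b₁

end Rings

section Presheaves

variable {T : TopCat.{u}} (A B : T.Presheaf CommRingCat.{u})
  (N : PresheafOfModules.{u} (A ⋙ forget₂ CommRingCat RingCat.{u})) (φ : B ⟶ A)

/-- The presheaf of abelian groups underlying a presheaf of modules. -/
abbrev absh {A : T.Presheaf CommRingCat.{u}}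
    (N : PresheafOfModules.{u} (A ⋙ forget₂ CommRingCat RingCat.{u})) : T.Presheaf Ab.{u} :=
  N.presheaf

/-- The ring of sections of `A` over `U` acts on the sections of `N` over `U`. -/
instance instModuleSections (U : (Opens T)ᵒᵖ) : Module (A.obj U) ((absh N).obj U) :=
  (N.obj U).isModule

lemma presheaf_map_smul {U V : (Opens T)ᵒᵖ} (i : U ⟶ V) (a : A.obj U) (m : (absh N).obj U) :
    ((absh N).map i).hom (a • m) = (A.map i).hom a • ((absh N).map i).hom m :=
  N.map_smul i a m

lemma presheaf_germ_smul (x : T) (U : Opens T) (hx : x ∈ U) (a : A.obj (op U))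
    (m : (absh N).obj (op U)) :
    ((absh N).germ U x hx).hom (a • m) =
      (A.germ U x hx).hom a • ((absh N).germ U x hx).hom m :=
  PresheafOfModules.germ_smul N x U hx a m

/-- The presheaf of rings `U ↦ A(U) ⊕ N(U)`. -/
def sqZeroPresheaf : T.Presheaf CommRingCat.{u} where
  obj U := CommRingCat.of (SqZero (A.obj U) ((absh N).obj U))
  map i := CommRingCat.ofHom (SqZero.map (A.map i).hom ((absh N).map i).hom
    (presheaf_map_smul A N i))
  map_id U := CommRingCat.hom_ext <| RingHom.ext fun (x : SqZero _ _) => SqZero.ext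
    (ConcreteCategory.congr_hom (A.map_id U) x.fst)
    (ConcreteCategory.congr_hom ((absh N).map_id U) x.snd)
  map_comp i j := CommRingCat.hom_ext <| RingHom.ext fun (x : SqZero _ _) => SqZero.ext
    (ConcreteCategory.congr_hom (A.map_comp i j) x.fst)
    (ConcreteCategory.congr_hom ((absh N).map_comp i j) x.snd)

/-- The presheaf of rings `U ↦ (A(U) ⊕ N(U)) ×_{A(U)} B(U)`. -/
def fibPresheaf : T.Presheaf CommRingCat.{u} where
  obj U := CommRingCat.of (Fib ((absh N).obj U) (φ.app U).hom)
  map i := CommRingCat.ofHom (Fib.map (A.map i).hom ((absh N).map i).hom (B.map i).hom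
    (presheaf_map_smul A N i) (fun b => congr($(φ.naturality i) b)))
  map_id U := CommRingCat.hom_ext <| RingHom.ext fun (x : Fib _ _) => Fib.ext'
    (ConcreteCategory.congr_hom ((absh N).map_id U) x.m)
    (ConcreteCategory.congr_hom (B.map_id U) x.b)
  map_comp i j := CommRingCat.hom_ext <| RingHom.ext fun (x : Fib _ _) => Fib.ext'
    (ConcreteCategory.congr_hom ((absh N).map_comp i j) x.m)
    (ConcreteCategory.congr_hom (B.map_comp i j) x.b)

variable {A B N φ}

lemma sqZeroPresheaf_isSheaf (hA : A.IsSheaf) (hN : (absh N).IsSheaf) :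
    (sqZeroPresheaf A N).IsSheaf := by
  rw [TopCat.Presheaf.isSheaf_iff_isSheafUniqueGluing]
  intro ι U sf hsf
  obtain ⟨a, ha, ha'⟩ := hA.isSheafUniqueGluing U (fun i => SqZero.fst (sf i))
    (fun i j => congrArg SqZero.fst (hsf i j))
  obtain ⟨m, hm, hm'⟩ := hN.isSheafUniqueGluing U (fun i => SqZero.snd (sf i))
    (fun i j => congrArg SqZero.snd (hsf i j))
  exact ⟨SqZero.mk a m, fun i => SqZero.ext (ha i) (hm i), fun s hs => SqZero.ext
    (ha' _ fun i => congrArg SqZero.fst (hs i)) (hm' _ fun i => congrArg SqZero.snd (hs i))⟩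

lemma fibPresheaf_isSheaf (hN : (absh N).IsSheaf) (hB : B.IsSheaf) :
    (fibPresheaf A B N φ).IsSheaf := by
  rw [TopCat.Presheaf.isSheaf_iff_isSheafUniqueGluing]
  intro ι U sf hsf
  obtain ⟨m, hm, hm'⟩ := hN.isSheafUniqueGluing U (fun i => Fib.m (sf i))
    (fun i j => congrArg (Fib.m) (hsf i j))
  obtain ⟨b, hb, hb'⟩ := hB.isSheafUniqueGluing U (fun i => Fib.b (sf i))
    (fun i j => congrArg (Fib.b) (hsf i j))
  exact ⟨Fib.mk _ m b, fun i => Fib.ext' (hm i) (hb i), fun s hs => Fib.ext'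
    (hm' _ fun i => congrArg (Fib.m) (hs i))
    (hb' _ fun i => congrArg (Fib.b) (hs i))⟩

variable (A B N φ)

variable {A B} in
/-- The map induced on stalks by a morphism of presheaves of rings. -/
def stalkRingHom (φ : B ⟶ A) (y : T) : B.stalk y →+* A.stalk y :=
  ((TopCat.Presheaf.stalkFunctor CommRingCat.{u} y).map φ).hom

variable {A B} in
lemma stalkRingHom_germ (φ : B ⟶ A) (y : T) (U : Opens T) (hy : y ∈ U) (b : B.obj (op U)) :
    stalkRingHom φ y (B.germ U y hy b) = A.germ U y hy (φ.app (op U) b) :=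
  TopCat.Presheaf.stalkFunctor_map_germ_apply U y hy φ b

/-- The canonical map from the stalk of `U ↦ (A(U) ⊕ N(U)) ×_{A(U)} B(U)` at `y` to
`(A_y ⊕ N_y) ×_{A_y} B_y`. -/
def fibStalkHom (y : T) : (fibPresheaf A B N φ).stalk y →+*
    Fib ((absh N).stalk y)
      (stalkRingHom φ y) :=
  (Limits.colimit.desc ((OpenNhds.inclusion y).op ⋙ fibPresheaf A B N φ)
    (Limits.Cocone.mk (CommRingCat.of (Fib ((absh N).stalk y)
      (stalkRingHom φ y)))
    { app := fun U => CommRingCat.ofHom (Fib.map (A.germ U.unop.1 y U.unop.2).hom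
        ((absh N).germ U.unop.1 y U.unop.2).hom (B.germ U.unop.1 y U.unop.2).hom
        (presheaf_germ_smul A N y _ _)
        (stalkRingHom_germ φ y U.unop.1 U.unop.2))
      naturality := fun _ _ i => CommRingCat.hom_ext <| RingHom.ext fun (_ : Fib _ _) => Fib.ext'
        (TopCat.Presheaf.germ_res_apply (absh N) ((OpenNhds.inclusion y).map i.unop) y _ _)
        (TopCat.Presheaf.germ_res_apply B ((OpenNhds.inclusion y).map i.unop) y _ _) })).hom

lemma fibStalkHom_germ (y : T) (U : Opens T) (hy : y ∈ U)
    (p : Fib ((absh N).obj (op U)) (φ.app (op U)).hom) :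
    fibStalkHom A B N φ y ((fibPresheaf A B N φ).germ U y hy p) =
      Fib.mk _ ((absh N).germ U y hy p.m) (B.germ U y hy p.b) := by
  refine (ConcreteCategory.congr_hom (Limits.colimit.ι_desc (F := (OpenNhds.inclusion y).op ⋙
    fibPresheaf A B N φ) _ (op ⟨U, hy⟩)) p).trans ?_
  exact Fib.ext' rfl rfl

lemma fibStalkHom_bijective (y : T) : Function.Bijective (fibStalkHom A B N φ y) := by
  constructor
  · intro s t hst
    obtain ⟨U, hU, s, rfl⟩ := (fibPresheaf A B N φ).exists_germ_eq s
    obtain ⟨V, hV, t, rfl⟩ := (fibPresheaf A B N φ).exists_germ_eq t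
    erw [fibStalkHom_germ, fibStalkHom_germ] at hst
    obtain ⟨W, hW, i, j, h⟩ := (absh N).germ_eq y hU hV _ _
      (congrArg (Fib.m) hst)
    obtain ⟨W', hW', i', j', h'⟩ := B.germ_eq y hU hV _ _ (congrArg (Fib.b) hst)
    have hc : (fibPresheaf A B N φ).map (homOfLE (inf_le_left.trans i.le) : W ⊓ W' ⟶ U).op s =
        (fibPresheaf A B N φ).map (homOfLE (inf_le_left.trans j.le) : W ⊓ W' ⟶ V).op t := by
      refine Fib.ext' ?_ ?_
      · have := congrArg ((absh N).map (homOfLE inf_le_left : W ⊓ W' ⟶ W).op) h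
        rwa [← ConcreteCategory.comp_apply, ← ConcreteCategory.comp_apply, ← Functor.map_comp,
          ← Functor.map_comp] at this
      · have := congrArg (B.map (homOfLE inf_le_right : W ⊓ W' ⟶ W').op) h'
        rwa [← ConcreteCategory.comp_apply, ← ConcreteCategory.comp_apply, ← Functor.map_comp,
          ← Functor.map_comp] at this
    have := congrArg ((fibPresheaf A B N φ).germ (W ⊓ W') y ⟨hW, hW'⟩) hc
    exact (TopCat.Presheaf.germ_res_apply _ _ y _ s).symm.trans
      (this.trans (TopCat.Presheaf.germ_res_apply _ _ y _ t))
  · rintro ⟨⟨c, b⟩, hp⟩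
    obtain ⟨U, hU, m, hm⟩ := (absh N).exists_germ_eq c.snd
    obtain ⟨V, hV, b, rfl⟩ := B.exists_germ_eq b
    refine ⟨(fibPresheaf A B N φ).germ (U ⊓ V) y ⟨hU, hV⟩ (Fib.mk _
      ((absh N).map (homOfLE inf_le_left : U ⊓ V ⟶ U).op m)
      (B.map (homOfLE inf_le_right : U ⊓ V ⟶ V).op b)), ?_⟩
    erw [fibStalkHom_germ]
    refine Fib.ext' ?_ ?_
    · exact (TopCat.Presheaf.germ_res_apply (absh N) _ y _ m).trans hm
    · exact TopCat.Presheaf.germ_res_apply B _ y _ b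

/-- The stalk of `U ↦ (A(U) ⊕ N(U)) ×_{A(U)} B(U)` at `y` is `(A_y ⊕ N_y) ×_{A_y} B_y`. -/
def fibStalkEquiv (y : T) : (fibPresheaf A B N φ).stalk y ≃+*
    Fib ((absh N).stalk y)
      (stalkRingHom φ y) :=
  RingEquiv.ofBijective _ (fibStalkHom_bijective A B N φ y)
end Presheaves

/-- A sheaf of rings `R` on the space of a scheme `Y`, with a map `π : R → 𝒪_Y` whose kernel has
square zero and which has a section `σ`. -/
structure SplitExtension (Y : Scheme.{u}) where
  R : TopCat.Presheaf CommRingCat.{u} Y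
  isSheaf : R.IsSheaf
  π : R ⟶ Y.presheaf
  σ : Y.presheaf ⟶ R
  π_σ : ∀ (U : (Opens Y)ᵒᵖ) (a : Y.presheaf.obj U), π.app U (σ.app U a) = a
  sq_zero : ∀ (U : (Opens Y)ᵒᵖ) (r s : R.obj U), π.app U r = 0 → π.app U s = 0 → r * s = 0

lemma bijective_of_isLocalization {B L Q : Type*} [CommRing B] [CommRing L] [CommRing Q] [Algebra B L]
    (p : Submonoid B) [IsLocalization p L] (ψ : L →+* Q)
    (h₀ : ∀ r, ψ (algebraMap B L r) = 0 → ∃ c ∈ p, c * r = 0)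
    (h₁ : ∀ q, ∃ c ∈ p, ∃ r, ψ (algebraMap B L r) = ψ (algebraMap B L c) * q) :
    Function.Bijective ψ := by
  constructor
  · rw [injective_iff_map_eq_zero]
    intro t ht
    obtain ⟨⟨r, s⟩, hrs⟩ := IsLocalization.surj (S := L) p t
    obtain ⟨c, hc, hcr⟩ := h₀ r (by rw [← hrs, map_mul, ht, zero_mul])
    rw [(IsLocalization.map_eq_zero_iff p L r).2 ⟨⟨c, hc⟩, hcr⟩] at hrs
    exact (IsUnit.mul_left_eq_zero (IsLocalization.map_units L s)).1 hrs
  · intro q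
    obtain ⟨c, hc, r, hr⟩ := h₁ q
    refine ⟨IsLocalization.mk' L r ⟨c, hc⟩, ?_⟩
    refine ((IsLocalization.map_units L ⟨c, hc⟩).map ψ).mul_left_cancel ?_
    rw [← hr, ← map_mul]
    exact congrArg ψ (IsLocalization.mk'_spec' L r ⟨c, hc⟩)

namespace SplitExtension

variable {Y : Scheme.{u}} (S : SplitExtension Y)

lemma stalk_π_isLocalHom (y : Y) : IsLocalHom (stalkRingHom S.π y) := by
  constructor
  intro t ht
  obtain ⟨U, hU, r, rfl⟩ := S.R.exists_germ_eq t
  rw [stalkRingHom_germ] at ht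
  obtain ⟨V, i, hV, hu⟩ : ∃ (V : Opens Y) (i : V ⟶ U) (_ : y ∈ V),
      IsUnit (Y.presheaf.map i.op (S.π.app (op U) r)) :=
    ⟨_, homOfLE (Y.toRingedSpace.basicOpen_le _), (Y.toRingedSpace.mem_basicOpen _ _ hU).2 ht,
      Y.toRingedSpace.isUnit_res_basicOpen _⟩
  have hn : S.π.app (op V) (S.R.map i.op r) = Y.presheaf.map i.op (S.π.app (op U) r) :=
    ConcreteCategory.congr_hom (S.π.naturality i.op) r
  rw [← hn] at hu
  rw [← TopCat.Presheaf.germ_res_apply S.R i y hV r]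
  refine IsUnit.map _ ?_
  generalize S.R.map i.op r = r at hu
  obtain ⟨c, hc⟩ := isUnit_iff_exists_inv.1 hu
  have h1 : (r * S.σ.app (op V) c - 1) * (r * S.σ.app (op V) c - 1) = 0 :=
    S.sq_zero _ _ _ (by simp [S.π_σ, hc]) (by simp [S.π_σ, hc])
  refine isUnit_iff_exists_inv.2 ⟨S.σ.app (op V) c * (2 - r * S.σ.app (op V) c), ?_⟩
  linear_combination -h1

/-- The locally ringed space `(|Y|, R)`. -/
def toLRS : LocallyRingedSpace.{u} where
  carrier := Y.carrier
  presheaf := S.R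
  IsSheaf := S.isSheaf
  isLocalRing y := haveI := S.stalk_π_isLocalHom y; (stalkRingHom S.π y).domain_isLocalRing

/-- The condition on an open subset `U` of `Y` that `R(U) → R(D(g))` is a localization away from
`g`, for all `g ∈ 𝒪_Y(U)`. -/
def IsLocalizingAt (U : Y.Opens) : Prop :=
  ∀ (g : Γ(Y, U)),
    (∀ r : S.R.obj (op U), S.R.map (homOfLE (Y.basicOpen_le g)).op r = 0 →
      ∃ n : ℕ, S.σ.app (op U) g ^ n * r = 0) ∧
    (∀ s : S.R.obj (op (Y.basicOpen g)), ∃ (n : ℕ) (r : S.R.obj (op U)),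
      S.R.map (homOfLE (Y.basicOpen_le g)).op r =
        S.R.map (homOfLE (Y.basicOpen_le g)).op (S.σ.app (op U) g) ^ n * s)

lemma isUnit_germ_iff (x : Y) (U : Opens Y) (hx : x ∈ U) (r : S.R.obj (op U)) :
    IsUnit (S.R.germ U x hx r) ↔ IsUnit (Y.presheaf.germ U x hx (S.π.app (op U) r)) := by
  have := S.stalk_π_isLocalHom x
  rw [← stalkRingHom_germ]
  exact (isUnit_map_iff (stalkRingHom S.π x) _).symm

lemma toΓSpecFun_eq (x : Y) : S.toLRS.toΓSpecFun x =
    PrimeSpectrum.comap (S.π.app (op ⊤)).hom (Y.toLocallyRingedSpace.toΓSpecFun x) := by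
  ext r
  rw [← not_iff_not]
  exact (S.toLRS.notMem_prime_iff_unit_in_stalk r x).trans <|
    (S.isUnit_germ_iff x ⊤ trivial r).trans
      (Y.toLocallyRingedSpace.notMem_prime_iff_unit_in_stalk (S.π.app (op ⊤) r) x).symm

lemma toΓSpec_isHomeomorph [IsAffine Y] : IsHomeomorph S.toLRS.toΓSpec.base := by
  have h : ⇑S.toLRS.toΓSpec.base =
      PrimeSpectrum.comap (S.π.app (op ⊤)).hom ∘ Y.toSpecΓ.base :=
    funext S.toΓSpecFun_eq
  rw [h]
  refine IsHomeomorph.comp (PrimeSpectrum.isHomeomorph_comap _ (fun x => ⟨1, one_pos, ?_⟩) ?_)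
    (Scheme.Hom.homeomorph Y.toSpecΓ).isHomeomorph
  · exact ⟨S.σ.app _ x, by simp [S.π_σ]⟩
  · intro r hr
    exact ⟨2, by rw [pow_two]; exact S.sq_zero _ _ _ hr hr⟩

lemma stalkMap_toΓSpec_bijective [IsAffine Y] (h : S.IsLocalizingAt ⊤) (x : Y) :
    Function.Bijective (S.toLRS.toΓSpec.stalkMap x).hom := by
  let B := S.R.obj (op ⊤)
  let p : PrimeSpectrum B := S.toLRS.toΓSpecFun x
  have hx : x ∈ (⊤ : Opens Y) := trivial
  have hp (r : B) : r ∉ p.asIdeal ↔ IsUnit (S.R.germ ⊤ x hx r) :=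
    S.toLRS.notMem_prime_iff_unit_in_stalk r x
  have hσ (g : Γ(Y, ⊤)) (hg : x ∈ Y.basicOpen g) (n : ℕ) :
      S.σ.app (op ⊤) g ^ n ∈ p.asIdeal.primeCompl := by
    refine fun hh => (hp _).2 ?_ (p.2.mem_of_pow_mem n hh)
    rw [S.isUnit_germ_iff, S.π_σ]
    exact (Y.mem_basicOpen g x hx).1 hg
  have hst (r : B) : (S.toLRS.toΓSpec.stalkMap x).hom (algebraMap B
      ((Spec.structureSheaf B).presheaf.stalk p) r) = S.R.germ ⊤ x hx r :=
    ConcreteCategory.congr_hom (S.toLRS.toStalk_stalkMap_toΓSpec x) r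
  have hbasis (U : Opens Y) (hU : x ∈ U) : ∃ g : Γ(Y, ⊤), x ∈ Y.basicOpen g ∧ Y.basicOpen g ≤ U := by
    obtain ⟨_, ⟨_, ⟨g, rfl⟩, rfl⟩, h1, h2⟩ := (isBasis_basicOpen Y).exists_subset_of_mem_open hU U.2
    exact ⟨g, h1, h2⟩
  refine bijective_of_isLocalization (L := (Spec.structureSheaf B).presheaf.stalk p)
    p.asIdeal.primeCompl _ (fun r hr => ?_) (fun t => ?_)
  · have h1 : S.R.germ ⊤ x hx r = S.R.germ ⊤ x hx 0 := (hst r).symm.trans (hr.trans (map_zero _).symm)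
    obtain ⟨U, hU, i, j, hr⟩ := S.R.germ_eq x hx hx r 0 h1
    obtain ⟨g, hxg, hg⟩ := hbasis U hU
    obtain ⟨n, hn⟩ := (h g).1 r (by
      have := congrArg (S.R.map (homOfLE hg).op) hr
      rw [← ConcreteCategory.comp_apply, ← ConcreteCategory.comp_apply, ← Functor.map_comp,
        ← Functor.map_comp] at this
      exact this.trans (map_zero _))
    exact ⟨_, hσ g hxg n, hn⟩
  · obtain ⟨U, hU, s, rfl⟩ := S.R.exists_germ_eq t
    obtain ⟨g, hxg, hg⟩ := hbasis U hU
    obtain ⟨n, r, hr⟩ := (h g).2 (S.R.map (homOfLE hg).op s)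
    refine ⟨_, hσ g hxg n, r, (hst r).trans (Eq.trans ?_ (congrArg (· * (S.R.germ U x hU s)) (hst _).symm : _))⟩
    have := congrArg (S.R.germ _ x hxg) hr
    rw [map_mul, map_pow, TopCat.Presheaf.germ_res_apply, TopCat.Presheaf.germ_res_apply,
      TopCat.Presheaf.germ_res_apply] at this
    rw [map_pow]
    exact this

lemma isIso_toΓSpec [IsAffine Y] (h : S.IsLocalizingAt ⊤) : IsIso S.toLRS.toΓSpec := by
  have (x : S.toLRS.1) : IsIso (S.toLRS.toΓSpec.stalkMap x) :=
    (ConcreteCategory.isIso_iff_bijective _).2 (S.stalkMap_toΓSpec_bijective h x)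
  have := LocallyRingedSpace.IsOpenImmersion.of_stalk_iso S.toLRS.toΓSpec
    S.toΓSpec_isHomeomorph.isOpenEmbedding
  have : Epi S.toLRS.toΓSpec.base :=
    (TopCat.epi_iff_surjective _).2 S.toΓSpec_isHomeomorph.surjective
  exact LocallyRingedSpace.IsOpenImmersion.to_iso _

/-- The restriction to an open subscheme. -/
def restrict (U : Y.Opens) : SplitExtension U.toScheme where
  R := U.isOpenEmbedding.functor.op ⋙ S.R
  isSheaf := (S.toLRS.toSheafedSpace.restrict U.isOpenEmbedding).IsSheaf
  π := Functor.whiskerLeft U.isOpenEmbedding.functor.op S.π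
  σ := Functor.whiskerLeft U.isOpenEmbedding.functor.op S.σ
  π_σ _ a := S.π_σ _ a
  sq_zero _ r s hr hs := S.sq_zero _ r s hr hs

lemma IsLocalizingAt.of_eq {S : SplitExtension Y} {U : Y.Opens} (h : S.IsLocalizingAt U)
    (g : Γ(Y, U)) (W : Y.Opens) (hW : W = Y.basicOpen g) (i : W ⟶ U) :
    (∀ r : S.R.obj (op U), S.R.map i.op r = 0 → ∃ n : ℕ, S.σ.app (op U) g ^ n * r = 0) ∧
    (∀ s : S.R.obj (op W), ∃ (n : ℕ) (r : S.R.obj (op U)),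
      S.R.map i.op r = S.R.map i.op (S.σ.app (op U) g) ^ n * s) := by
  subst hW
  exact h g

lemma restrict_isLocalizingAt (U : Y.Opens) (h : S.IsLocalizingAt (U.ι ''ᵁ ⊤)) :
    (S.restrict U).IsLocalizingAt ⊤ := by
  intro g
  exact h.of_eq g (U.ι ''ᵁ U.toScheme.basicOpen g) (U.ι_image_basicOpen g)
    (U.isOpenEmbedding.functor.map (homOfLE (U.toScheme.basicOpen_le g)))

/-- The scheme `(|Y|, R)`, where `R` is a split square-zero extension of `𝒪_Y` whose kernel
is quasi-coherent. -/
def toScheme (h : ∀ U : Y.Opens, IsAffineOpen U → S.IsLocalizingAt U) : Scheme.{u} where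
  toLocallyRingedSpace := S.toLRS
  local_affine x := by
    obtain ⟨_, ⟨U, hU, rfl⟩, hxU, -⟩ := Y.isBasis_affineOpens.exists_subset_of_mem_open
      (Set.mem_univ (x : Y)) isOpen_univ
    have : IsAffine (Scheme.Opens.toScheme U) := hU
    have := (S.restrict U).isIso_toΓSpec (S.restrict_isLocalizingAt U (h _ (by
      rw [Scheme.Opens.ι_image_top]; exact hU)))
    exact ⟨⟨U, hxU⟩, _, ⟨@asIso _ _ _ _ _ this⟩⟩

end SplitExtension

lemma fromSpec_appIso_inv {X : Scheme.{u}} {V : X.Opens} (hV : IsAffineOpen V)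
    (U : (Spec Γ(X, V)).Opens) (h : hV.fromSpec ''ᵁ U ≤ V) :
    (Scheme.ΓSpecIso Γ(X, V)).inv ≫ (Spec Γ(X, V)).presheaf.map U.leTop.op ≫
      (hV.fromSpec.appIso U).inv = X.presheaf.map (homOfLE h).op := by
  have e : U ≤ hV.fromSpec ⁻¹ᵁ V := by rw [hV.fromSpec_preimage_self]; exact le_top
  have h1 := hV.fromSpec.appLE_appIso_inv e
  rw [Scheme.Hom.appLE, hV.fromSpec_app_self, Category.assoc, Category.assoc,
    ← Functor.map_comp_assoc] at h1
  exact h1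

/-- The two halves of the statement that `Γ(M, D(g))` is the localization of `Γ(M, V)` away
from `g`, where `V` is affine and `W = D(g)`. -/
lemma quasicoherent_localizing {X : Scheme.{u}} (M : X.Modules) [M.IsQuasicoherent] {V : X.Opens}
    (hV : IsAffineOpen V) (g : Γ(X, V)) (W : X.Opens) (hW : W = X.basicOpen g) (i : W ⟶ V) :
    (∀ m : Γ(M, V), M.presheaf.map i.op m = 0 → ∃ n : ℕ, g ^ n • m = 0) ∧
    (∀ s : Γ(M, W), ∃ (n : ℕ) (m : Γ(M, V)),
      M.presheaf.map i.op m = X.presheaf.map i.op g ^ n • s) := by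
  have key : ∀ (V' W' : X.Opens) (hV' : V' = V) (hW' : W' = X.basicOpen g) (i' : W' ⟶ V'),
      ((∀ m : Γ(M, V'), M.presheaf.map i'.op m = 0 → ∃ n : ℕ,
        X.presheaf.map (eqToHom hV').op g ^ n • m = 0) ∧
      (∀ s : Γ(M, W'), ∃ (n : ℕ) (m : Γ(M, V')),
        M.presheaf.map i'.op m = X.presheaf.map (i' ≫ eqToHom hV').op g ^ n • s)) →
      ((∀ m : Γ(M, V), M.presheaf.map i.op m = 0 → ∃ n : ℕ, g ^ n • m = 0) ∧
      (∀ s : Γ(M, W), ∃ (n : ℕ) (m : Γ(M, V)),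
        M.presheaf.map i.op m = X.presheaf.map i.op g ^ n • s)) := by
    rintro V' W' rfl rfl i' h
    subst hW
    obtain rfl : i = i' := Subsingleton.elim _ _
    simpa using h
  refine key (hV.fromSpec ''ᵁ ⊤) (hV.fromSpec ''ᵁ PrimeSpectrum.basicOpen g)
    (by rw [Scheme.Hom.image_top_eq_opensRange, hV.opensRange_fromSpec])
    (hV.fromSpec_image_basicOpen g) (hV.fromSpec.opensFunctor.map (Opens.leTop _)) ?_
  have hl := (isIso_fromTildeΓ_iff_isLocalizing (M.restrict hV.fromSpec)).1 inferInstance g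
  have e0 := fun m => (@IsLocalizedModule.eq_zero_iff _ _ (.powers g) _ _ _ _ _ _ _ hl m).1
  have e1 := @IsLocalizedModule.surj _ _ _ _ _ _ _ _ (.powers g) _ hl
  have es (U : (Spec Γ(X, V)).Opens) (hU : hV.fromSpec ''ᵁ U ≤ V) (m : Γ(M, hV.fromSpec ''ᵁ U)) (r : Γ(X, V)) :
      X.presheaf.map (homOfLE hU).op r • m =
        (r • (show Γ(M.restrict hV.fromSpec, U) from m) : Γ(M.restrict hV.fromSpec, U)) := by
    rw [← fromSpec_appIso_inv hV U hU]
    rfl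
  constructor
  · intro m hm
    obtain ⟨⟨_, n, rfl⟩, hn⟩ := e0 m hm
    refine ⟨n, ?_⟩
    rw [← map_pow]
    refine Eq.trans ?_ hn
    exact es _ _ _ _
  · intro s
    obtain ⟨⟨m, ⟨_, n, rfl⟩⟩, hn⟩ := e1 s
    refine ⟨n, m, hn.symm.trans ?_⟩
    rw [← map_pow]
    exact (es _ _ _ _).symm

lemma isLocalHom_stalkMap {Y Z : LocallyRingedSpace.{u}} (F : Y.toPresheafedSpace.Hom Z.toPresheafedSpace)
    (h : ∀ (y : Y) (U : Opens Z) (hy : F.base y ∈ U) (s : Z.presheaf.obj (op U)),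
      IsUnit (Y.presheaf.germ ((Opens.map F.base).obj U) y hy (F.c.app (op U) s)) →
        IsUnit (Z.presheaf.germ U (F.base y) hy s)) (y : Y) : IsLocalHom (F.stalkMap y).hom := by
  constructor
  intro t ht
  obtain ⟨U, hU, s, rfl⟩ := Z.presheaf.exists_germ_eq t
  refine h y U hU s ?_
  rwa [← PresheafedSpace.stalkMap_germ_apply F U y hU s]

namespace SplitExtension

variable {Y : Scheme.{u}} (S : SplitExtension Y)
  (h : ∀ U : Y.Opens, IsAffineOpen U → S.IsLocalizingAt U)

/-- The morphism `Y ⟶ (|Y|, R)` which is the identity on spaces and is given by `π`. -/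
def ι : Y ⟶ S.toScheme h :=
  Scheme.Hom.mk
    { base := 𝟙 _
      c := S.π
      prop := isLocalHom_stalkMap (Y := Y.toLocallyRingedSpace) (Z := S.toLRS) ⟨𝟙 _, S.π⟩
        fun y U hy s hs => (S.isUnit_germ_iff y U hy s).2 hs }

/-- The morphism `(|Y|, R) ⟶ Y` which is the identity on spaces and is given by `σ`. -/
def ρ : S.toScheme h ⟶ Y :=
  Scheme.Hom.mk
    { base := 𝟙 _
      c := S.σ
      prop := isLocalHom_stalkMap (Y := S.toLRS) (Z := Y.toLocallyRingedSpace) ⟨𝟙 _, S.σ⟩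
        fun y U hy s hs => by
          have := (S.isUnit_germ_iff y U hy (S.σ.app (op U) s)).1 hs
          rwa [S.π_σ] at this }

end SplitExtension

lemma structureSheaf_localizing {X : Scheme.{u}} {V : X.Opens}
    (hV : IsAffineOpen V) (g : Γ(X, V)) (i : X.basicOpen g ⟶ V) :
    (∀ a : Γ(X, V), X.presheaf.map i.op a = 0 → ∃ n : ℕ, g ^ n * a = 0) ∧
    (∀ s : Γ(X, X.basicOpen g), ∃ (n : ℕ) (a : Γ(X, V)),
      X.presheaf.map i.op a = X.presheaf.map i.op g ^ n * s) := by
  let := (X.presheaf.map i.op).hom.toAlgebra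
  have hl : IsLocalization.Away g Γ(X, X.basicOpen g) := hV.isLocalization_basicOpen g
  constructor
  · intro a ha
    obtain ⟨⟨_, n, rfl⟩, hn⟩ := (IsLocalization.map_eq_zero_iff (.powers g) Γ(X, X.basicOpen g) a).1 ha
    exact ⟨n, hn⟩
  · intro s
    obtain ⟨n, a, h⟩ := IsLocalization.Away.surj g s
    exact ⟨n, a, h.symm.trans (by rw [mul_comm]; rfl)⟩

lemma SqZero.incl_pow_mul {A M : Type*} [CommRing A] [AddCommGroup M] [Module A M] (g : A) (n : ℕ)
    (x : SqZero A M) : SqZero.incl A M g ^ n * x = SqZero.mk (g ^ n * x.fst) (g ^ n • x.snd) := by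
  rw [← map_pow]
  ext <;> simp

lemma Fib.ofB_pow_mul {A B M : Type*} [CommRing A] [CommRing B] [AddCommGroup M] [Module A M]
    (f : B →+* A) (g : B) (n : ℕ) (x : Fib M f) :
    Fib.ofB f g ^ n * x = Fib.mk f (f g ^ n • x.m) (g ^ n * x.b) := by
  rw [← map_pow]
  exact Fib.ext' (by simp [Fib.ofB]) (by simp [Fib.ofB])

/-- The presheaf of modules underlying a sheaf of modules on a scheme. -/
def preMod {X : Scheme.{u}} (M : X.Modules) :
    PresheafOfModules.{u} (X.presheaf ⋙ forget₂ CommRingCat RingCat.{u}) :=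
  M.val

section SquareZero

variable (X : Scheme.{u}) (M : X.Modules)

/-- The sheaf of rings `𝒪_X ⊕ M` on `X`, with its projection to `𝒪_X` and the inclusion of `𝒪_X`. -/
def sqZeroExtension : SplitExtension X where
  R := sqZeroPresheaf X.presheaf (preMod M)
  isSheaf := sqZeroPresheaf_isSheaf X.IsSheaf M.isSheaf
  π :=
    { app := fun U => CommRingCat.ofHom (SqZero.proj (X.presheaf.obj U) ((absh (preMod M)).obj U))
      naturality := fun _ _ _ => rfl }
  σ :=
    { app := fun U => CommRingCat.ofHom (SqZero.incl (X.presheaf.obj U) ((absh (preMod M)).obj U))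
      naturality := fun _ _ i => CommRingCat.hom_ext <| RingHom.ext fun a => SqZero.ext rfl
        (map_zero ((absh (preMod M)).map i).hom).symm }
  π_σ _ _ := rfl
  sq_zero U r s hr hs := by
    change SqZero (X.presheaf.obj U) ((absh (preMod M)).obj U) at r s
    change r.fst = 0 at hr
    change s.fst = 0 at hs
    exact SqZero.ext ((SqZero.fst_mul r s).trans (by rw [hr, zero_mul]; rfl))
      ((SqZero.snd_mul r s).trans (by rw [hr, hs, zero_smul, zero_smul, add_zero]; rfl))

lemma sqZeroExtension_isLocalizingAt [M.IsQuasicoherent] (U : X.Opens) (hU : IsAffineOpen U) :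
    (sqZeroExtension X M).IsLocalizingAt U := by
  intro g
  have h1 := structureSheaf_localizing hU g (homOfLE (X.basicOpen_le g))
  have h2 := quasicoherent_localizing M hU g _ rfl (homOfLE (X.basicOpen_le g))
  constructor
  · intro (r : SqZero _ _) hr
    obtain ⟨n₁, hn₁⟩ := h1.1 r.fst (congrArg SqZero.fst hr)
    obtain ⟨n₂, hn₂⟩ := h2.1 r.snd (congrArg SqZero.snd hr)
    refine ⟨n₁ + n₂, (SqZero.incl_pow_mul g _ r).trans (SqZero.ext ?_ ?_)⟩
    · change g ^ (n₁ + n₂) * r.fst = 0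
      rw [add_comm, pow_add, mul_assoc, hn₁, mul_zero]
    · change g ^ (n₁ + n₂) • (show Γ(M, U) from r.snd) = 0
      rw [pow_add, mul_smul, hn₂, smul_zero]
  · intro (s : SqZero _ _)
    obtain ⟨n₁, a, hn₁⟩ := h1.2 s.fst
    obtain ⟨n₂, m, hn₂⟩ := h2.2 s.snd
    refine ⟨n₁ + n₂, SqZero.mk (g ^ n₂ * a) (g ^ n₁ • m), ?_⟩
    rw [show (sqZeroExtension X M).R.map (homOfLE (X.basicOpen_le g)).op ((sqZeroExtension X M).σ.app (op U) g) =
      (sqZeroExtension X M).σ.app _ (X.presheaf.map (homOfLE (X.basicOpen_le g)).op g) from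
      (ConcreteCategory.congr_hom ((sqZeroExtension X M).σ.naturality (homOfLE (X.basicOpen_le g)).op) g).symm]
    refine Eq.trans ?_ (SqZero.incl_pow_mul (X.presheaf.map (homOfLE (X.basicOpen_le g)).op g) _ s).symm
    refine SqZero.ext ?_ ?_
    · change X.presheaf.map _ (g ^ n₂ * a) = X.presheaf.map _ g ^ (n₁ + n₂) * s.fst
      rw [map_mul, hn₁, map_pow, pow_add]
      ring
    · change M.presheaf.map _ (g ^ n₁ • m) = X.presheaf.map _ g ^ (n₁ + n₂) • (show Γ(M, _) from s.snd)
      rw [Scheme.Modules.map_smul, hn₂, map_pow, pow_add]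
      exact (mul_smul _ _ (show Γ(M, _) from s.snd)).symm

end SquareZero

section Pushout

variable {X Y : Scheme.{u}} (f : X ⟶ Y) (M : X.Modules)

/-- The sheaf of rings `f_* 𝒪_X`. -/
abbrev pushO : TopCat.Presheaf CommRingCat.{u} Y := f.base _* X.presheaf

/-- The sheaf of `f_* 𝒪_X`-modules `f_* M`. -/
abbrev pushM : PresheafOfModules.{u} (pushO f ⋙ forget₂ CommRingCat RingCat.{u}) :=
  (PresheafOfModules.pushforward₀OfCommRingCat (Opens.map f.base) X.presheaf).obj (preMod M)

/-- The sheaf of rings `(f_* 𝒪_X ⊕ f_* M) ×_{f_* 𝒪_X} 𝒪_Y` on `Y`, with its projection to `𝒪_Y` and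
the section `b ↦ ((f^# b, 0), b)`. -/
def pushoutExtension : SplitExtension Y where
  R := fibPresheaf (pushO f) Y.presheaf (pushM f M) f.c
  isSheaf := fibPresheaf_isSheaf ((Scheme.Modules.pushforward f).obj M).isSheaf Y.IsSheaf
  π :=
    { app := fun U => CommRingCat.ofHom (Fib.toB (M := (absh (pushM f M)).obj U) (f.c.app U).hom)
      naturality := fun _ _ _ => rfl }
  σ :=
    { app := fun U => CommRingCat.ofHom (Fib.ofB (M := (absh (pushM f M)).obj U) (f.c.app U).hom)
      naturality := fun _ _ i => CommRingCat.hom_ext <| RingHom.ext fun a => Fib.ext'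
        (map_zero ((absh (pushM f M)).map i).hom).symm rfl }
  π_σ _ _ := rfl
  sq_zero U r s hr hs := by
    change Fib ((absh (pushM f M)).obj U) (f.c.app U).hom at r s
    change r.b = 0 at hr
    change s.b = 0 at hs
    exact Fib.ext' ((Fib.m_mul r s).trans (by rw [hr, hs, map_zero, zero_smul, zero_smul, add_zero]; rfl))
      ((Fib.b_mul r s).trans (by rw [hr, zero_mul]; rfl))

lemma pushoutExtension_isLocalizingAt [M.IsQuasicoherent] [IsAffineHom f] (U : Y.Opens)
    (hU : IsAffineOpen U) : (pushoutExtension f M).IsLocalizingAt U := by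
  intro g
  have h1 := structureSheaf_localizing hU g (homOfLE (Y.basicOpen_le g))
  have h2 := quasicoherent_localizing M (hU.preimage f) (f.app U g) _
    (Scheme.preimage_basicOpen f g) ((Opens.map f.base).map (homOfLE (Y.basicOpen_le g)))
  have h3 : X.presheaf.map ((Opens.map f.base).map (homOfLE (Y.basicOpen_le g))).op (f.app U g) =
      f.app _ (Y.presheaf.map (homOfLE (Y.basicOpen_le g)).op g) :=
    (ConcreteCategory.congr_hom (f.c.naturality (homOfLE (Y.basicOpen_le g)).op) g).symm
  constructor
  · intro (r : Fib _ _) hr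
    obtain ⟨n₁, hn₁⟩ := h1.1 r.b (congrArg Fib.b hr)
    obtain ⟨n₂, hn₂⟩ := h2.1 r.m (congrArg Fib.m hr)
    refine ⟨n₁ + n₂, (Fib.ofB_pow_mul _ g _ r).trans (Fib.ext' ?_ ?_)⟩
    · change f.app U g ^ (n₁ + n₂) • (show Γ(M, f ⁻¹ᵁ U) from r.m) = 0
      rw [pow_add, mul_smul, hn₂, smul_zero]
    · change g ^ (n₁ + n₂) * r.b = 0
      rw [add_comm, pow_add, mul_assoc, hn₁, mul_zero]
  · intro (s : Fib _ _)
    obtain ⟨n₁, b, hn₁⟩ := h1.2 s.b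
    obtain ⟨n₂, m, hn₂⟩ := h2.2 s.m
    refine ⟨n₁ + n₂, Fib.mk _ (f.app U g ^ n₁ • m) (g ^ n₂ * b), ?_⟩
    rw [show (pushoutExtension f M).R.map (homOfLE (Y.basicOpen_le g)).op ((pushoutExtension f M).σ.app (op U) g) =
      (pushoutExtension f M).σ.app _ (Y.presheaf.map (homOfLE (Y.basicOpen_le g)).op g) from
      (ConcreteCategory.congr_hom ((pushoutExtension f M).σ.naturality (homOfLE (Y.basicOpen_le g)).op) g).symm]
    refine Eq.trans ?_ (Fib.ofB_pow_mul _ (Y.presheaf.map (homOfLE (Y.basicOpen_le g)).op g) _ s).symm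
    refine Fib.ext' ?_ ?_
    · change M.presheaf.map ((Opens.map f.base).map (homOfLE (Y.basicOpen_le g))).op
        (f.app U g ^ n₁ • m) = f.app _ (Y.presheaf.map (homOfLE (Y.basicOpen_le g)).op g) ^ (n₁ + n₂) •
          (show Γ(M, _) from s.m)
      rw [Scheme.Modules.map_smul, hn₂, map_pow, pow_add, h3]
      exact (mul_smul _ _ (show Γ(M, _) from s.m)).symm
    · change Y.presheaf.map _ (g ^ n₂ * b) = Y.presheaf.map _ g ^ (n₁ + n₂) * s.b
      rw [map_mul, hn₁, map_pow, pow_add]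
      ring

end Pushout

section Schemes

section

variable (X : Scheme.{u}) (M : X.Modules) [M.IsQuasicoherent]

/-- The scheme `X ⊕ M`: its underlying space is `|X|`, its structure sheaf is `𝒪_X ⊕ M`. -/
def sqZeroScheme : Scheme.{u} :=
  (sqZeroExtension X M).toScheme (sqZeroExtension_isLocalizingAt X M)

/-- The morphism `i_X : X ⟶ X ⊕ M`, given by the projection `𝒪_X ⊕ M → 𝒪_X`. -/
def iX : X ⟶ sqZeroScheme X M := (sqZeroExtension X M).ι _

/-- The morphism `e_M : X ⊕ M ⟶ X`, given by the inclusion `𝒪_X → 𝒪_X ⊕ M`. -/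
def eM : sqZeroScheme X M ⟶ X := (sqZeroExtension X M).ρ _

end

section

variable {X Y : Scheme.{u}} (f : X ⟶ Y) (M : X.Modules)

lemma isUnit_germ_of_isUnit (x : X) (U : Opens Y) (hx : f x ∈ U)
    (p : Fib ((absh (pushM f M)).obj (op U)) (f.c.app (op U)).hom)
    (h : IsUnit (X.presheaf.germ (f ⁻¹ᵁ U) x hx (f.app U p.b))) :
    IsUnit ((pushoutExtension f M).R.germ U (f x) hx p) := by
  refine ((pushoutExtension f M).isUnit_germ_iff _ U hx p).2 ?_
  rw [← f.germ_stalkMap_apply U x hx] at h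
  exact (isUnit_map_iff (f.stalkMap x).hom _).1 h

/-- The projection of `(f_* 𝒪_X ⊕ f_* M) ×_{f_* 𝒪_X} 𝒪_Y` to `f_* (𝒪_X ⊕ M)`. -/
def toSqZeroSharp : (pushoutExtension f M).R ⟶ f.base _* (sqZeroExtension X M).R where
  app U := CommRingCat.ofHom (Fib.toSqZero (M := (absh (pushM f M)).obj U) (f.c.app U).hom)
  naturality _ _ i := CommRingCat.hom_ext <| RingHom.ext fun (p : Fib _ _) =>
    SqZero.ext ((ConcreteCategory.congr_hom (f.c.naturality i) p.b).trans
      (congrArg ((pushO f).map i) p.fst_eq.symm)) rfl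

lemma toSqZeroSharp_π :
    toSqZeroSharp f M ≫ Functor.whiskerLeft (Opens.map f.base).op (sqZeroExtension X M).π =
      (pushoutExtension f M).π ≫ f.c :=
  NatTrans.ext <| funext fun U => CommRingCat.hom_ext <| RingHom.ext
    fun (p : Fib ((absh (pushM f M)).obj U) (f.c.app U).hom) => p.fst_eq

lemma isUnit_germ_of_toSqZeroSharp (x : X) (U : Opens Y) (hx : f x ∈ U)
    (p : Fib ((absh (pushM f M)).obj (op U)) (f.c.app (op U)).hom)
    (h : IsUnit ((sqZeroExtension X M).R.germ (f ⁻¹ᵁ U) x hx ((toSqZeroSharp f M).app (op U) p))) :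
    IsUnit ((pushoutExtension f M).R.germ U (f x) hx p) := by
  refine isUnit_germ_of_isUnit f M x U hx p ?_
  have h := ((sqZeroExtension X M).isUnit_germ_iff x _ hx _).1 h
  change IsUnit (X.presheaf.germ (f ⁻¹ᵁ U) x hx p.1.1.fst) at h
  rwa [p.fst_eq] at h

end

variable {X Y : Scheme.{u}} (f : X ⟶ Y) [IsClosedImmersion f] (M : X.Modules) [M.IsQuasicoherent]

/-- The pushout `(X ⊕ M) ⨿_X Y` of `i_X` and a closed immersion `f : X ⟶ Y`: its underlying space
is `|Y|`, its structure sheaf is `(f_* 𝒪_X ⊕ f_* M) ×_{f_* 𝒪_X} 𝒪_Y`. -/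
def pushoutScheme : Scheme.{u} :=
  (pushoutExtension f M).toScheme (pushoutExtension_isLocalizingAt f M)

/-- The morphism `j_Y : Y ⟶ (X ⊕ M) ⨿_X Y`, which is the identity on spaces. -/
def jY : Y ⟶ pushoutScheme f M := (pushoutExtension f M).ι _

/-- The morphism `θ : (X ⊕ M) ⨿_X Y ⟶ Y`, which is the identity on spaces. -/
def theta : pushoutScheme f M ⟶ Y := (pushoutExtension f M).ρ _

/-- The morphism `j_{X ⊕ M} : X ⊕ M ⟶ (X ⊕ M) ⨿_X Y`, which is `f` on spaces. -/
def jXM : sqZeroScheme X M ⟶ pushoutScheme f M :=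
  Scheme.Hom.mk
    { base := f.base
      c := toSqZeroSharp f M
      prop := isLocalHom_stalkMap (Y := (sqZeroExtension X M).toLRS)
        (Z := (pushoutExtension f M).toLRS) ⟨f.base, toSqZeroSharp f M⟩
        (isUnit_germ_of_toSqZeroSharp f M) }

lemma scheme_hom_ext {Y Z : Scheme.{u}} (F G : Y ⟶ Z) (b : Y.carrier ⟶ Z.carrier)
    (c₁ c₂ : Z.presheaf ⟶ b _* Y.presheaf)
    (hF : F.toLRSHom.toHom = PresheafedSpace.Hom.mk b c₁)
    (hG : G.toLRSHom.toHom = PresheafedSpace.Hom.mk b c₂) (h : c₁ = c₂) : F = G :=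
  Scheme.Hom.ext' (LocallyRingedSpace.Hom.ext' (by rw [hF, hG, h]))

lemma iX_jXM : iX X M ≫ jXM f M = f ≫ jY f M := by
  refine scheme_hom_ext _ _ f.base
    (toSqZeroSharp f M ≫ Functor.whiskerLeft (Opens.map f.base).op (sqZeroExtension X M).π)
    ((pushoutExtension f M).π ≫ f.c) rfl rfl ?_
  exact toSqZeroSharp_π f M

/-- The structure morphism `i_X ⨿ f : X ⟶ (X ⊕ M) ⨿_X Y` of the pushout as a scheme under `X`. -/
def pushoutStr : X ⟶ pushoutScheme f M := f ≫ jY f M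

end Schemes

section Pushout
section
variable {X Y : Scheme.{u}} (f : X ⟶ Y) (M : X.Modules) {W : TopCat.{u}} {C : W.Presheaf CommRingCat.{u}}
  {b : (Y.carrier : TopCat.{u}) ⟶ W}
  (c₁ : C ⟶ (f.base ≫ b) _* (sqZeroExtension X M).R) (c₂ : C ⟶ b _* Y.presheaf)
  (h : c₁ ≫ Functor.whiskerLeft (Opens.map (f.base ≫ b)).op (sqZeroExtension X M).π =
    c₂ ≫ Functor.whiskerLeft (Opens.map b).op f.c)

/-- The map to `(f_* 𝒪_X ⊕ f_* M) ×_{f_* 𝒪_X} 𝒪_Y` with given components. -/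
def fibLift : C ⟶ b _* (pushoutExtension f M).R where
  app U := CommRingCat.ofHom
    (RingHom.codRestrict ((c₁.app U).hom.prod (c₂.app U).hom)
      (fibSubring ((absh (pushM f M)).obj ((Opens.map b).op.obj U))
        (f.c.app ((Opens.map b).op.obj U)).hom) fun s =>
        ConcreteCategory.congr_hom (NatTrans.congr_app h U) s)
  naturality U V i := CommRingCat.hom_ext <| RingHom.ext fun s => Fib.ext'
    (by have e := congrArg SqZero.snd (ConcreteCategory.congr_hom (c₁.naturality i) s); exact e)
    (ConcreteCategory.congr_hom (c₂.naturality i) s)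

lemma fibLift_ext (c c' : C ⟶ b _* (pushoutExtension f M).R)
    (h₁ : c ≫ Functor.whiskerLeft (Opens.map b).op (toSqZeroSharp f M) =
      c' ≫ Functor.whiskerLeft (Opens.map b).op (toSqZeroSharp f M))
    (h₂ : c ≫ Functor.whiskerLeft (Opens.map b).op (pushoutExtension f M).π =
      c' ≫ Functor.whiskerLeft (Opens.map b).op (pushoutExtension f M).π) : c = c' :=
  NatTrans.ext <| funext fun U => CommRingCat.hom_ext <| RingHom.ext fun s => Fib.ext'
    (by have e := congrArg SqZero.snd (ConcreteCategory.congr_hom (NatTrans.congr_app h₁ U) s); exact e)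
    (ConcreteCategory.congr_hom (NatTrans.congr_app h₂ U) s)

end

variable {X Y : Scheme.{u}} (f : X ⟶ Y) [IsClosedImmersion f] (M : X.Modules) [M.IsQuasicoherent]

lemma c_eq_of_eq {Y Z : Scheme.{u}} {F G : Y ⟶ Z} (h : F = G) (b : Y.carrier ⟶ Z.carrier)
    (c₁ c₂ : Z.presheaf ⟶ b _* Y.presheaf)
    (hF : F.toLRSHom.toHom = PresheafedSpace.Hom.mk b c₁)
    (hG : G.toLRSHom.toHom = PresheafedSpace.Hom.mk b c₂) : c₁ = c₂ := by
  rw [h, hG] at hF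
  exact (eq_of_heq (PresheafedSpace.Hom.mk.inj hF).2).symm

lemma exists_desc {W : Scheme.{u}} (u : sqZeroScheme X M ⟶ W) (v : Y ⟶ W)
    (w : iX X M ≫ u = f ≫ v) : ∃ d : pushoutScheme f M ⟶ W, jXM f M ≫ d = u ∧ jY f M ≫ d = v := by
  obtain ⟨⟨⟨ub, uc⟩, hu⟩⟩ := u
  have hb : ub = f.base ≫ v.base := congrArg (fun F : X ⟶ W => F.base) w
  subst hb
  have hc := c_eq_of_eq w (f.base ≫ v.base) _ _ rfl rfl
  have hl (y : Y) (U : Opens W) (hy : v.base y ∈ U) (s : W.presheaf.obj (op U))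
      (h : IsUnit ((pushoutExtension f M).R.germ ((Opens.map v.base).obj U) y hy
        ((fibLift f M uc v.c hc).app (op U) s))) : IsUnit (W.presheaf.germ U (v.base y) hy s) := by
    have h' := ((pushoutExtension f M).isUnit_germ_iff y _ hy _).1 h
    change IsUnit (Y.presheaf.germ (v ⁻¹ᵁ U) y hy (v.app U s)) at h'
    rw [← v.germ_stalkMap_apply U y hy] at h'
    exact (isUnit_map_iff (v.stalkMap y).hom _).1 h'
  refine ⟨Scheme.Hom.mk
    { base := v.base
      c := fibLift f M uc v.c hc
      prop := isLocalHom_stalkMap (Y := (pushoutExtension f M).toLRS)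
        (Z := W.toLocallyRingedSpace) ⟨v.base, fibLift f M uc v.c hc⟩ hl }, ?_, ?_⟩
  · exact scheme_hom_ext _ _ (f.base ≫ v.base) _ _ rfl rfl rfl
  · exact scheme_hom_ext _ _ v.base _ _ rfl rfl rfl

lemma desc_unique {W : Scheme.{u}} (d d' : pushoutScheme f M ⟶ W) (h₁ : jXM f M ≫ d = jXM f M ≫ d')
    (h₂ : jY f M ≫ d = jY f M ≫ d') : d = d' := by
  obtain ⟨⟨⟨b, c⟩, hd⟩⟩ := d
  obtain ⟨⟨⟨b', c'⟩, hd'⟩⟩ := d'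
  have hb : b = b' := congrArg (fun F : Y ⟶ W => F.base) h₂
  subst hb
  have hc₁ := c_eq_of_eq h₁ (f.base ≫ b) _ _ rfl rfl
  have hc₂ := c_eq_of_eq h₂ b _ _ rfl rfl
  exact scheme_hom_ext _ _ b c c' rfl rfl (fibLift_ext f M _ _ hc₁ hc₂)

/-- `(X ⊕ M) ⨿_X Y` is a pushout in the category of schemes. -/
lemma isPushout : IsPushout (iX X M) f (jXM f M) (jY f M) := by
  refine ⟨⟨iX_jXM f M⟩, ⟨Limits.PushoutCocone.isColimitAux' _ fun s => ?_⟩⟩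
  have h := exists_desc f M s.inl s.inr s.condition
  exact ⟨h.choose, h.choose_spec.1, h.choose_spec.2, fun h₁ h₂ => desc_unique f M _ _
    (h₁.trans h.choose_spec.1.symm) (h₂.trans h.choose_spec.2.symm)⟩

end Pushout

section Stalks

/-- The map on stalks at `y` induced by a morphism from a presheaf of abelian groups to a presheaf
of rings. -/
def stalkAddHom {T : TopCat.{u}} {N : T.Presheaf Ab.{u}} {B : T.Presheaf CommRingCat.{u}}
    (α : ∀ U : (Opens T)ᵒᵖ, N.obj U →+ B.obj U)
    (hα : ∀ (U V : (Opens T)ᵒᵖ) (i : U ⟶ V) (n : N.obj U), α V (N.map i n) = B.map i (α U n))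
    (y : T) : N.stalk y →+ B.stalk y :=
  (Limits.colimit.desc ((OpenNhds.inclusion y).op ⋙ N)
    (Limits.Cocone.mk (AddCommGrpCat.of (B.stalk y))
      { app := fun U => AddCommGrpCat.ofHom
          ((B.germ U.unop.1 y U.unop.2).hom.toAddMonoidHom.comp (α (op U.unop.1)))
        naturality := fun _ V i => AddCommGrpCat.hom_ext <| AddMonoidHom.ext fun n =>
          (congrArg (B.germ V.unop.1 y V.unop.2) (hα _ _ ((OpenNhds.inclusion y).map i.unop).op n)).trans
            (TopCat.Presheaf.germ_res_apply B ((OpenNhds.inclusion y).map i.unop) y _ _) })).hom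

lemma stalkAddHom_germ {T : TopCat.{u}} {N : T.Presheaf Ab.{u}} {B : T.Presheaf CommRingCat.{u}}
    (α : ∀ U : (Opens T)ᵒᵖ, N.obj U →+ B.obj U)
    (hα : ∀ (U V : (Opens T)ᵒᵖ) (i : U ⟶ V) (n : N.obj U), α V (N.map i n) = B.map i (α U n))
    (y : T) (U : Opens T) (hy : y ∈ U) (n : N.obj (op U)) :
    stalkAddHom α hα y (N.germ U y hy n) = B.germ U y hy (α (op U) n) :=
  ConcreteCategory.congr_hom (Limits.colimit.ι_desc (F := (OpenNhds.inclusion y).op ⋙ N) _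
    (op ⟨U, hy⟩)) n

variable {X Y Z : Scheme.{u}} (f : X ⟶ Y) (M : X.Modules)

/-- The stalk `M_x`. -/
abbrev stalkM (x : X) : Type u := (absh (preMod M)).stalk x

/-- The canonical isomorphism `(f_* M)_{f(x)} ≅ M_x` for a closed immersion `f`. -/
def stalkPushEquiv [IsClosedImmersion f] (x : X) :
    (absh (pushM f M)).stalk (f x) ≃+ stalkM M x :=
  haveI : IsIso (TopCat.Presheaf.stalkPushforward Ab.{u} f.base (absh (preMod M)) x) :=
    TopCat.Presheaf.stalkPushforward.stalkPushforward_iso_of_isInducing Ab.{u}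
      f.isClosedEmbedding.isInducing _ x
  (asIso (TopCat.Presheaf.stalkPushforward Ab.{u} f.base (absh (preMod M)) x)).addCommGroupIsoToAddEquiv

lemma stalkPushEquiv_germ [IsClosedImmersion f] (x : X) (U : Opens Y) (hx : f x ∈ U)
    (m : (absh (pushM f M)).obj (op U)) :
    stalkPushEquiv f M x ((absh (pushM f M)).germ U (f x) hx m) =
      (absh (preMod M)).germ (f ⁻¹ᵁ U) x hx m :=
  ConcreteCategory.congr_hom
    (TopCat.Presheaf.stalkPushforward_germ Ab.{u} f.base (absh (preMod M)) U x hx) m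

variable {f} in
/-- For a morphism `h : Y ⟶ Z` with `f ≫ h = g`, the map `h^#_x : 𝒪_{Z,g(x)} → 𝒪_{Y,f(x)}`. -/
def stalkUnder {g : X ⟶ Z} (h : Y ⟶ Z) (w : f ≫ h = g) (x : X) :
    Z.presheaf.stalk (g x) →+* Y.presheaf.stalk (f x) :=
  (Z.presheaf.stalkSpecializes
    (specializes_of_eq (by rw [← w]; rfl) : h (f x) ⤳ g x) ≫ h.stalkMap (f x)).hom

variable {f} in
lemma stalkUnder_germ {g : X ⟶ Z} (h : Y ⟶ Z) (w : f ≫ h = g) (x : X) (U : Z.Opens) (hx : g x ∈ U)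
    (hx' : f x ∈ h ⁻¹ᵁ U) (s : Γ(Z, U)) :
    stalkUnder h w x (Z.presheaf.germ U (g x) hx s) =
      Y.presheaf.germ (h ⁻¹ᵁ U) (f x) hx' (h.app U s) := by
  subst w
  refine (congrArg (h.stalkMap (f x)) (TopCat.Presheaf.germ_stalkSpecializes_apply Z.presheaf hx _ s)).trans ?_
  exact h.germ_stalkMap_apply U (f x) hx' s

end Stalks

section Thickenings

variable {X Y : Scheme.{u}} (f : X ⟶ Y)

/-- The structure sheaf `𝒪_X`, as an `𝒪_X`-module. -/
def unitMod (X : Scheme.{u}) : X.Modules := SheafOfModules.unit X.ringCatSheaf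

/-- The morphism `f^# : 𝒪_Y → f_* 𝒪_X` of `𝒪_Y`-modules. -/
def sharp : unitMod Y ⟶ (Scheme.Modules.pushforward f).obj (unitMod X) :=
  SheafOfModules.unitToPushforwardObjUnit f.toRingCatSheafHom

/-- The `𝒪_Y`-module `I_f = ker (f^# : 𝒪_Y → f_* 𝒪_X)`. -/
def idealSheaf : Y.Modules := Limits.kernel (sharp f)

/-- The inclusion of `I_f` into `𝒪_Y`. -/
def idealι : idealSheaf f ⟶ unitMod Y := Limits.kernel.ι (sharp f)

variable {f} {M : X.Modules} (α : (Scheme.Modules.pushforward f).obj M ⟶ idealSheaf f)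

/-- The map `Γ(X, f⁻¹ U, M) → Γ(Y, U, 𝒪_Y)` underlying `α : f_* M ⟶ I_f ⊆ 𝒪_Y`. -/
def sectionMap (U : (Opens Y)ᵒᵖ) : (absh (pushM f M)).obj U →+ Y.presheaf.obj U :=
  ((α ≫ idealι f).app U.unop).hom

lemma sectionMap_map (U V : (Opens Y)ᵒᵖ) (i : U ⟶ V) (m : (absh (pushM f M)).obj U) :
    sectionMap α V ((absh (pushM f M)).map i m) = Y.presheaf.map i (sectionMap α U m) :=
  ConcreteCategory.congr_hom ((α ≫ idealι f).mapPresheaf.naturality i) m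

lemma sectionMap_smul (U : (Opens Y)ᵒᵖ) (b : Y.presheaf.obj U) (m : (absh (pushM f M)).obj U) :
    sectionMap α U (f.c.app U b • m) = b * sectionMap α U m :=
  Scheme.Modules.Hom.app_smul (U := U.unop) (α ≫ idealι f) b m

lemma sharp_sectionMap (U : (Opens Y)ᵒᵖ) (m : (absh (pushM f M)).obj U) :
    f.c.app U (sectionMap α U m) = 0 := by
  have h : (α ≫ idealι f) ≫ sharp f = 0 := by
    rw [Category.assoc, show idealι f ≫ sharp f = 0 from Limits.kernel.condition (sharp f),
      Limits.comp_zero]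
  exact ConcreteCategory.congr_hom (congrArg (fun φ => Scheme.Modules.Hom.app φ U.unop) h) m

/-- The map `α_{f,x} : M_x → 𝒪_{Y,f(x)}` induced by `α : f_* M ⟶ I_f` on stalks. -/
def stalkα [IsClosedImmersion f] (x : X) : stalkM M x →+ Y.presheaf.stalk (f x) :=
  (stalkAddHom (sectionMap α) (sectionMap_map α) (f x)).comp
    (stalkPushEquiv f M x).symm.toAddMonoidHom

variable (X) in
/-- A first order thickening of `X` by `M`: a surjective closed immersion `f : X ⟶ Y` together with
an isomorphism `α : f_* M ≅ I_f` of `𝒪_Y`-modules such that, for each `x`, the ring homomorphism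
`f^#_x : 𝒪_{Y,f(x)} → 𝒪_{X,x}` together with `α_{f,x}` is a square-zero extension by `M_x`. -/
structure FirstOrderThickening (M : X.Modules) where
  Y : Scheme.{u}
  f : X ⟶ Y
  [isClosedImmersion : IsClosedImmersion f]
  [surjective : Surjective f]
  α : (Scheme.Modules.pushforward f).obj M ≅ idealSheaf f
  isSquareZeroExtension : ∀ x : X, IsSquareZeroExtension (f.stalkMap x).hom (stalkα α.hom x)

end Thickenings

section Categories

variable {X Y Z W : Scheme.{u}}

lemma stalkUnder_id (f : X ⟶ Y) (x : X) (t : Y.presheaf.stalk (f x)) :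
    stalkUnder (𝟙 Y) (Category.comp_id f) x t = t := by
  obtain ⟨U, hU, s, rfl⟩ := Y.presheaf.exists_germ_eq t
  exact stalkUnder_germ (𝟙 Y) (Category.comp_id f) x U hU hU s

lemma stalkUnder_comp {f : X ⟶ Y} {g : X ⟶ Z} {k : X ⟶ W} (h : Y ⟶ Z) (h' : Z ⟶ W)
    (w : f ≫ h = g) (w' : g ≫ h' = k) (w'' : f ≫ h ≫ h' = k) (x : X) (t : W.presheaf.stalk (k x)) :
    stalkUnder (h ≫ h') w'' x t = stalkUnder h w x (stalkUnder h' w' x t) := by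
  subst w
  subst w'
  obtain ⟨U, hU, s, rfl⟩ := W.presheaf.exists_germ_eq t
  refine (stalkUnder_germ (h ≫ h') w'' x U hU hU s).trans ?_
  refine Eq.trans ?_ (congrArg _ (stalkUnder_germ h' rfl x U hU hU s)).symm
  exact (stalkUnder_germ h rfl x (h' ⁻¹ᵁ U) hU hU (h'.app U s)).symm

attribute [instance] FirstOrderThickening.isClosedImmersion FirstOrderThickening.surjective

namespace FirstOrderThickening

variable {M : X.Modules}

/-- A morphism of first order thickenings: a morphism `h` of schemes under `X` such that, for each
`x`, the map `h^#_x : 𝒪_{Z,g(x)} → 𝒪_{Y,f(x)}` satisfies `h^#_x(α_{g,x}(m)) = α_{f,x}(m)`. -/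
@[ext] structure Hom (S T : FirstOrderThickening X M) where
  h : S.Y ⟶ T.Y
  comm : S.f ≫ h = T.f
  map_α : ∀ (x : X) (m : stalkM M x), stalkUnder h comm x (stalkα T.α.hom x m) = stalkα S.α.hom x m

/-- The category of first order thickenings of `X` by `M`. -/
instance : Category (FirstOrderThickening X M) where
  Hom := Hom
  id S :=
    { h := 𝟙 S.Y
      comm := Category.comp_id _
      map_α := fun _ _ => stalkUnder_id _ _ _ }
  comp {S T U} a b :=
    { h := a.h ≫ b.h
      comm := by rw [← Category.assoc, a.comm, b.comm]
      map_α := fun x m => by rw [stalkUnder_comp a.h b.h a.comm b.comm, b.map_α, a.map_α] }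
  id_comp _ := Hom.ext (Category.id_comp _)
  comp_id _ := Hom.ext (Category.comp_id _)
  assoc _ _ _ := Hom.ext (Category.assoc _ _ _)

end FirstOrderThickening

section Action

variable {f : X ⟶ Y} [IsClosedImmersion f] {M : X.Modules} [M.IsQuasicoherent]
  (τ : Y ⟶ pushoutScheme f M) (hτ : ∀ y, τ y = jY f M y)

/-- The map `τ^#_{f,y} : ((f_* 𝒪_X)_y ⊕ (f_* M)_y) ×_{(f_* 𝒪_X)_y} 𝒪_{Y,y} → 𝒪_{Y,y}` induced on stalks
by a morphism `τ : Y ⟶ (X ⊕ M) ⨿_X Y` which is the identity on spaces. -/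
def stalkτ (y : Y) :
    Fib ((absh (pushM f M)).stalk y) (stalkRingHom f.c y) →+* Y.presheaf.stalk y :=
  ((τ.stalkMap y).hom.comp ((pushoutScheme f M).presheaf.stalkSpecializes
    (specializes_of_eq (hτ y))).hom).comp
      (fibStalkEquiv (pushO f) Y.presheaf (pushM f M) f.c y).symm.toRingHom

/-- The action `τ_{f,x}(m, b)` of `m ∈ M_x` on `b ∈ 𝒪_{Y,f(x)}`. -/
def act (x : X) (m : stalkM M x) (b : Y.presheaf.stalk (f x)) : Y.presheaf.stalk (f x) :=
  stalkτ τ hτ (f x) (Fib.mk _ ((stalkPushEquiv f M x).symm m) b)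

end Action

variable (X) in
/-- An `M`-cotorsor: a closed immersion `f : X ⟶ Y` together with a morphism
`τ : Y ⟶ (X ⊕ M) ⨿_X Y` of schemes under `X` which is the identity on topological spaces (that is,
it agrees on points with `j_Y`, which is the identity map), such that, for each `y`, the ring
homomorphism `f^#_y : 𝒪_{Y,y} → (f_* 𝒪_X)_y` together with `τ^#_{f,y}` is an `(f_* M)_y`-torsor. -/
structure Cotorsor (M : X.Modules) [M.IsQuasicoherent] where
  Y : Scheme.{u}
  f : X ⟶ Y
  [isClosedImmersion : IsClosedImmersion f]
  τ : Y ⟶ pushoutScheme f M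
  comm : f ≫ τ = pushoutStr f M
  τ_eq : ∀ y : Y, τ y = jY f M y
  isTorsor : ∀ y : Y, IsTorsor (stalkRingHom f.c y) (stalkτ τ τ_eq y)

attribute [instance] Cotorsor.isClosedImmersion

namespace Cotorsor

variable {M : X.Modules} [M.IsQuasicoherent]

/-- A morphism of `M`-cotorsors: a morphism `h` of schemes under `X` such that, for each `x`, the
map `h^#_x` satisfies `h^#_x(τ_{g,x}(m, c)) = τ_{f,x}(m, h^#_x(c))`. -/
@[ext] structure Hom (S T : Cotorsor X M) where
  h : S.Y ⟶ T.Y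
  comm : S.f ≫ h = T.f
  map_act : ∀ (x : X) (m : stalkM M x) (c : T.Y.presheaf.stalk (T.f x)),
    stalkUnder h comm x (act T.τ T.τ_eq x m c) = act S.τ S.τ_eq x m (stalkUnder h comm x c)

/-- The category of `M`-cotorsors. -/
instance : Category (Cotorsor X M) where
  Hom := Hom
  id S :=
    { h := 𝟙 S.Y
      comm := Category.comp_id _
      map_act := fun _ _ _ => by rw [stalkUnder_id, stalkUnder_id] }
  comp {S T U} a b :=
    { h := a.h ≫ b.h
      comm := by rw [← Category.assoc, a.comm, b.comm]
      map_act := fun x m c => by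
        rw [stalkUnder_comp a.h b.h a.comm b.comm, stalkUnder_comp a.h b.h a.comm b.comm,
          b.map_act, a.map_act] }
  id_comp _ := Hom.ext (Category.id_comp _)
  comp_id _ := Hom.ext (Category.comp_id _)
  assoc _ _ _ := Hom.ext (Category.assoc _ _ _)

end Cotorsor

end Categories

/-- The ring homomorphism `τ : (A ⊕ M) ×_A B → B` with `τ(m, b) = α(m) + b`, for an additive map
`α : M → B` with suitable properties. -/
def Fib.ofAdd {A B M : Type*} [CommRing A] [CommRing B] [AddCommGroup M] [Module A M] {f : B →+* A}
    (α : M →+ B) (h : ∀ (b : B) (m : M), α (f b • m) = b * α m) (h' : ∀ m m', α m * α m' = 0) :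
    Fib M f →+* B where
  toFun p := α p.m + p.b
  map_one' := by simp
  map_mul' p q := by
    rw [m_mul, b_mul, map_add, h, h]
    linear_combination -h' p.m q.m
  map_zero' := by simp
  map_add' p q := by
    rw [m_add, b_add, map_add]
    ring

lemma isUnit_of_isUnit_add {B : Type*} [CommRing B] {a b : B} (ha : a * a = 0) (h : IsUnit (a + b)) :
    IsUnit b := by
  obtain ⟨c, hc⟩ := isUnit_iff_exists_inv.1 h
  refine isUnit_iff_exists_inv.2 ⟨c * (1 + a * c), ?_⟩
  linear_combination (1 + a * c) * hc - c * c * ha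

namespace FirstOrderThickening

variable {X : Scheme.{u}} {M : X.Modules} (T : FirstOrderThickening X M)

lemma stalkα_germ (x : X) (U : Opens T.Y) (hx : T.f x ∈ U) (m : (absh (pushM T.f M)).obj (op U)) :
    stalkα T.α.hom x ((absh (preMod M)).germ (T.f ⁻¹ᵁ U) x hx m) =
      T.Y.presheaf.germ U (T.f x) hx (sectionMap T.α.hom (op U) m) := by
  rw [← stalkPushEquiv_germ T.f M x U hx m]
  refine (congrArg _ ((stalkPushEquiv T.f M x).symm_apply_apply _)).trans ?_
  exact stalkAddHom_germ _ _ _ _ _ _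

lemma stalkα_mul (x : X) (m m' : stalkM M x) : stalkα T.α.hom x m * stalkα T.α.hom x m' = 0 := by
  have h := T.isSquareZeroExtension x
  have hm (m : stalkM M x) : stalkα T.α.hom x m ∈ RingHom.ker (T.f.stalkMap x).hom :=
    h.range_eq.subset ⟨m, rfl⟩
  have := Ideal.mul_mem_mul (hm m) (hm m')
  rwa [← pow_two, h.sq_eq_bot] at this

lemma sectionMap_mul (U : (Opens T.Y)ᵒᵖ) (m m' : (absh (pushM T.f M)).obj U) :
    sectionMap T.α.hom U m * sectionMap T.α.hom U m' = 0 := by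
  refine TopCat.Presheaf.section_ext T.Y.sheaf U.unop _ _ fun y hy => ?_
  obtain ⟨x, rfl⟩ := T.f.surjective y
  change T.Y.presheaf.germ U.unop (T.f x) hy _ = T.Y.presheaf.germ U.unop (T.f x) hy _
  rw [map_mul, map_zero]
  have h (m) := T.stalkα_germ x U.unop hy m
  refine (congrArg₂ (· * ·) (h m).symm (h m').symm).trans (T.stalkα_mul x _ _)

/-- The morphism `τ_f^#`, given by `τ_f^#((a, m), b) = α_f(m) + b` on sections. -/
def tauSharp : (pushoutExtension T.f M).R ⟶ T.Y.presheaf where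
  app U := CommRingCat.ofHom (Fib.ofAdd (f := (T.f.c.app U).hom) (sectionMap T.α.hom U)
    (sectionMap_smul T.α.hom U) (T.sectionMap_mul U))
  naturality U V i := CommRingCat.hom_ext <| RingHom.ext fun (p : Fib _ _) =>
    (congrArg (· + T.Y.presheaf.map i p.b) (sectionMap_map T.α.hom U V i p.m)).trans
      (map_add (T.Y.presheaf.map i).hom _ _).symm

lemma tauSharp_app (U : (Opens T.Y)ᵒᵖ) (p : Fib ((absh (pushM T.f M)).obj U) (T.f.c.app U).hom) :
    T.tauSharp.app U p = sectionMap T.α.hom U p.m + p.b := rfl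

lemma isUnit_germ_of_tauSharp (y : T.Y) (U : Opens T.Y) (hy : y ∈ U)
    (p : Fib ((absh (pushM T.f M)).obj (op U)) (T.f.c.app (op U)).hom)
    (h : IsUnit (T.Y.presheaf.germ U y hy (T.tauSharp.app (op U) p))) :
    IsUnit ((pushoutExtension T.f M).R.germ U y hy p) := by
  refine ((pushoutExtension T.f M).isUnit_germ_iff y U hy p).2 ?_
  rw [tauSharp_app, map_add] at h
  refine isUnit_of_isUnit_add ?_ h
  rw [← map_mul, sectionMap_mul, map_zero]

lemma tauSharp_comp : T.tauSharp ≫ T.f.c = (pushoutExtension T.f M).π ≫ T.f.c :=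
  NatTrans.ext <| funext fun U => CommRingCat.hom_ext <| RingHom.ext
    fun (p : Fib ((absh (pushM T.f M)).obj U) (T.f.c.app U).hom) =>
      (map_add (T.f.c.app U).hom _ _).trans (by
        rw [show (T.f.c.app U).hom (sectionMap T.α.hom U p.m) = 0 from sharp_sectionMap T.α.hom U p.m,
          zero_add]
        rfl)

variable [M.IsQuasicoherent]

/-- The morphism `τ_f : Y ⟶ (X ⊕ M) ⨿_X Y`, which is the identity on spaces and is given by
`τ_f^#((a, m), b) = α_f(m) + b` on sections. -/
def tau : T.Y ⟶ pushoutScheme T.f M :=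
  Scheme.Hom.mk
    { base := 𝟙 _
      c := T.tauSharp
      prop := isLocalHom_stalkMap (Y := T.Y.toLocallyRingedSpace)
        (Z := (pushoutExtension T.f M).toLRS) ⟨𝟙 _, T.tauSharp⟩ T.isUnit_germ_of_tauSharp }

lemma f_tau : T.f ≫ T.tau = pushoutStr T.f M :=
  scheme_hom_ext _ _ T.f.base _ _ rfl rfl T.tauSharp_comp

lemma tau_eq (y : T.Y) : T.tau y = jY T.f M y := rfl

lemma stalkτ_tau (y : T.Y) (q : Fib ((absh (pushM T.f M)).stalk y) (stalkRingHom T.f.c y)) :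
    stalkτ T.tau T.tau_eq y q =
      stalkAddHom (sectionMap T.α.hom) (sectionMap_map T.α.hom) y q.m + q.b := by
  obtain ⟨t, rfl⟩ := (fibStalkEquiv (pushO T.f) T.Y.presheaf (pushM T.f M) T.f.c y).surjective q
  obtain ⟨U, hU, p, rfl⟩ := TopCat.Presheaf.exists_germ_eq _ t
  change Fib ((absh (pushM T.f M)).obj (op U)) (T.f.c.app (op U)).hom at p
  have h1 : stalkτ T.tau T.tau_eq y (fibStalkEquiv (pushO T.f) T.Y.presheaf (pushM T.f M) T.f.c y
      ((fibPresheaf (pushO T.f) T.Y.presheaf (pushM T.f M) T.f.c).germ U y hU p)) =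
      T.Y.presheaf.germ U y hU (T.tauSharp.app (op U) p) := by
    refine (congrArg (fun t => (T.tau.stalkMap y).hom
      (((pushoutScheme T.f M).presheaf.stalkSpecializes (specializes_of_eq (T.tau_eq y))).hom t))
      (RingEquiv.symm_apply_apply _ _)).trans ?_
    refine (congrArg (T.tau.stalkMap y).hom (TopCat.Presheaf.germ_stalkSpecializes_apply
      (pushoutScheme T.f M).presheaf (U := U) hU (specializes_of_eq (T.tau_eq y)) p)).trans ?_
    exact T.tau.germ_stalkMap_apply U y hU p
  rw [h1]
  have h2 : fibStalkEquiv (pushO T.f) T.Y.presheaf (pushM T.f M) T.f.c y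
      ((fibPresheaf (pushO T.f) T.Y.presheaf (pushM T.f M) T.f.c).germ U y hU p) = Fib.mk _ _ _ :=
    fibStalkHom_germ (pushO T.f) T.Y.presheaf (pushM T.f M) T.f.c y U hU p
  rw [h2, tauSharp_app, map_add, Fib.m_mk, Fib.b_mk, stalkAddHom_germ]

/-- On stalks, `τ_f` is the torsor structure associated with the square-zero extension:
`τ_{f,x}(m, b) = α_{f,x}(m) + b`. -/
lemma act_tau (x : X) (m : stalkM M x) (b : T.Y.presheaf.stalk (T.f x)) :
    act T.tau T.tau_eq x m b = stalkα T.α.hom x m + b :=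
  T.stalkτ_tau _ _

/-- The isomorphism `(f_* 𝒪_X)_{f(x)} ≅ 𝒪_{X,x}` is compatible with the maps from `𝒪_{Y,f(x)}`. -/
lemma stalkMap_eq (x : X) (b : T.Y.presheaf.stalk (T.f x)) :
    (T.f.stalkMap x).hom b =
      TopCat.Presheaf.stalkPushforward CommRingCat.{u} T.f.base X.presheaf x (stalkRingHom T.f.c (T.f x) b) :=
  rfl

lemma isTorsor_tau (y : T.Y) : IsTorsor (stalkRingHom T.f.c y) (stalkτ T.tau T.tau_eq y) := by
  obtain ⟨x, rfl⟩ := T.f.surjective y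
  have : IsIso (TopCat.Presheaf.stalkPushforward CommRingCat.{u} T.f.base X.presheaf x) :=
    TopCat.Presheaf.stalkPushforward.stalkPushforward_iso_of_isInducing CommRingCat.{u}
      T.f.isClosedEmbedding.isInducing _ x
  have hbij : Function.Bijective (TopCat.Presheaf.stalkPushforward CommRingCat.{u} T.f.base X.presheaf x) :=
    ConcreteCategory.bijective_of_isIso _
  have h := T.isSquareZeroExtension x
  let e := stalkPushEquiv T.f M x
  let β := stalkAddHom (sectionMap T.α.hom) (sectionMap_map T.α.hom) (T.f x)
  have hβ (n : (absh (pushM T.f M)).stalk (T.f x)) : β n = stalkα T.α.hom x (e n) :=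
    (congrArg β (e.symm_apply_apply n)).symm
  have hker (b : T.Y.presheaf.stalk (T.f x)) :
      stalkRingHom T.f.c (T.f x) b = 0 ↔ b ∈ RingHom.ker (T.f.stalkMap x).hom := by
    rw [RingHom.mem_ker, stalkMap_eq, map_eq_zero_iff _ hbij.1]
  have hz (n : (absh (pushM T.f M)).stalk (T.f x)) : stalkRingHom T.f.c (T.f x) (β n) = 0 :=
    (hker _).2 (h.range_eq.subset ⟨e n, (hβ n).symm⟩)
  refine ⟨fun a => ?_, fun p => ?_, fun b => ?_, fun b₁ b₂ hb => ?_⟩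
  · obtain ⟨b, hb⟩ := h.surjective (TopCat.Presheaf.stalkPushforward CommRingCat.{u} T.f.base X.presheaf x a)
    exact ⟨b, hbij.1 hb⟩
  · rw [T.stalkτ_tau, map_add, hz, zero_add]
  · rw [T.stalkτ_tau, Fib.m_mk, Fib.b_mk, map_zero, zero_add]
  · obtain ⟨m, hm⟩ := h.range_eq.symm.subset ((hker (b₁ - b₂)).1 (by rw [map_sub, hb, sub_self]))
    refine ⟨e.symm m, ?_, fun n hn => ?_⟩
    · change stalkτ T.tau T.tau_eq _ _ = _
      rw [T.stalkτ_tau, Fib.m_mk, Fib.b_mk, hβ, e.apply_symm_apply, hm, sub_add_cancel]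
    · change stalkτ T.tau T.tau_eq _ _ = _ at hn
      rw [T.stalkτ_tau, Fib.m_mk, Fib.b_mk, hβ] at hn
      rw [AddEquiv.eq_symm_apply]
      refine h.injective ?_
      rw [hm, ← hn, add_sub_cancel_right]

end FirstOrderThickening

/-- The functor `Φ` from first order thickenings of `X` by `M` to `M`-cotorsors: it sends `(f, α_f)`
to `(f, τ_f)`, where `τ_f(m, b) = α_f(m) + b`, and a morphism to itself. -/
def Phi (X : Scheme.{u}) (M : X.Modules) [M.IsQuasicoherent] :
    FirstOrderThickening X M ⥤ Cotorsor X M where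
  obj T :=
    { Y := T.Y
      f := T.f
      τ := T.tau
      comm := T.f_tau
      τ_eq := T.tau_eq
      isTorsor := T.isTorsor_tau }
  map {S T} a :=
    { h := a.h
      comm := a.comm
      map_act := fun x m c => by
        change stalkUnder a.h a.comm x (act T.tau T.tau_eq x m c) =
          act S.tau S.tau_eq x m (stalkUnder a.h a.comm x c)
        rw [T.act_tau, S.act_tau, map_add, a.map_α] }
  map_id _ := rfl
  map_comp _ _ := rfl

end

end SqZeroThickening

/-!
The functor `Φ` is an equivalence because a torsor structure is determined by how the module moves
zero. For a ring homomorphism `τ : (A ⊕ M) ×_A B → B` with `τ(0, b) = b`, additivity gives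
`τ(m, b) = α(m) + b` with `α(m) = τ(m, 0)`; multiplicativity makes `α` linear over `B` with
`α(m) α(m') = 0`, and simple transitivity says that `α` is a bijection onto the kernel of `B → A`.
So torsors and square-zero extensions are the same data
(`Fib.eq_actZero_add`, `IsTorsor.isSquareZeroExtension`).

`Φ` is faithful since a morphism is sent to itself, and full since the condition on a morphism of
cotorsors, read at the element `0` of the local ring, is the condition on a morphism of thickenings.

For essential surjectivity, let `(f : X ⟶ Y, τ)` be a cotorsor. Outside the image of `f` the stalk
of `f_* 𝒪_X` vanishes, and a torsor over the zero ring is zero, whereas a local ring is not; hence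
`f` is surjective. As `τ` is the identity on spaces, it is given by a morphism of sheaves of rings
`τ^#` (`Cotorsor.sharp`), and `m ↦ τ^#(m, 0)` is a morphism `f_* M ⟶ 𝒪_Y` of `𝒪_Y`-modules whose
composition with `f^#` is zero. It is injective on stalks, with image the kernel of `f^#`, so it is
injective on sections, with image the kernel of `f^#` (`injective_of_stalkAddHom`,
`exists_eq_of_stalkAddHom`): it is a kernel of `f^#` (`isIso_kernel_lift`). The resulting thickening
`Cotorsor.toThickening` is sent by `Φ` to the given cotorsor, on the nose
(`Cotorsor.Phi_obj_toThickening`).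
-/

namespace SqZeroThickening

noncomputable section

/-! ### Torsors and square-zero extensions of rings -/

section Rings

variable {A B M : Type*} [CommRing A] [CommRing B] [AddCommGroup M] [Module A M] {f : B →+* A}

/-- The additive map `m ↦ τ(m, 0)` attached to a ring homomorphism `τ : (A ⊕ M) ×_A B → B`. -/
@[simps]
def Fib.actZero (τ : Fib M f →+* B) : M →+ B where
  toFun m := τ (Fib.mk f m 0)
  map_zero' := (congrArg τ (Fib.ext' rfl rfl : Fib.mk f (0 : M) 0 = 0)).trans (map_zero τ)
  map_add' m m' := by
    rw [← map_add]
    exact congrArg τ (Fib.ext' rfl (add_zero 0).symm)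

lemma Fib.eq_actZero_add {τ : Fib M f →+* B} (h : ∀ b : B, τ (Fib.mk f (0 : M) b) = b)
    (p : Fib M f) : τ p = Fib.actZero τ p.m + p.b := by
  rw [← h p.b, Fib.actZero_apply, ← map_add]
  exact congrArg τ (Fib.ext' (by simp) (by simp))

/-- The elements `(0, m)` and `(0, m')` of `A ⊕ M` have product zero, and `τ` is multiplicative. -/
lemma Fib.actZero_mul (τ : Fib M f →+* B) (m m' : M) :
    Fib.actZero τ m * Fib.actZero τ m' = 0 := by
  rw [Fib.actZero_apply, Fib.actZero_apply, ← map_mul, ← map_zero τ]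
  exact congrArg τ (Fib.ext' (by simp) (by simp))

lemma Fib.actZero_smul {τ : Fib M f →+* B} (h : ∀ b : B, τ (Fib.mk f (0 : M) b) = b) (b : B)
    (m : M) : Fib.actZero τ (f b • m) = b * Fib.actZero τ m := by
  conv_rhs => rw [← h b]
  rw [Fib.actZero_apply, Fib.actZero_apply, ← map_mul]
  exact congrArg τ (Fib.ext' (by simp) (by simp))

/-- The action of `m` on `b` is `τ(m, b) = τ(m, 0) + b`, so that the elements `τ(m, 0)` are exactly
the differences of elements of `B` with the same image in `A`. -/
theorem IsTorsor.isSquareZeroExtension {τ : Fib M f →+* B} (h : IsTorsor f τ) :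
    IsSquareZeroExtension f (Fib.actZero τ) := by
  have hr : Set.range (Fib.actZero τ) = RingHom.ker f := by
    ext b
    constructor
    · rintro ⟨m, rfl⟩
      exact (h.map_eq _).trans (map_zero f)
    · intro hb
      obtain ⟨m, hm, -⟩ := h.existsUnique b 0 (((RingHom.mem_ker).1 hb).trans (map_zero f).symm)
      exact ⟨m, hm⟩
  refine ⟨h.surjective, ?_, Fib.actZero_smul h.zero_act, fun m m' hm => ?_, hr⟩
  · rw [pow_two, eq_bot_iff, Ideal.mul_le]
    intro a ha b hb
    obtain ⟨m, rfl⟩ := hr.symm.subset ha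
    obtain ⟨m', rfl⟩ := hr.symm.subset hb
    exact (Fib.actZero_mul τ m m')
  · exact (h.existsUnique (Fib.actZero τ m') 0 ((h.map_eq _))).unique hm rfl

/-- Square-zero extensions are transported along an isomorphism `(ψ, e)` of the base ring and the
module. -/
lemma IsSquareZeroExtension.of_equiv {A' M' : Type*} [CommRing A'] [AddCommGroup M'] [Module A' M']
    {α : M →+ B} (h : IsSquareZeroExtension f α) (f' : B →+* A') (ψ : A →+* A')
    (hψ : Function.Bijective ψ) (hf : ∀ b, f' b = ψ (f b)) (e : M ≃+ M')
    (he : ∀ b m, e (f b • m) = f' b • e m) :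
    IsSquareZeroExtension f' (α.comp e.symm.toAddMonoidHom) := by
  have hk : RingHom.ker f' = RingHom.ker f := by
    ext b
    rw [RingHom.mem_ker, RingHom.mem_ker, hf, map_eq_zero_iff ψ hψ.1]
  refine ⟨fun a => ?_, hk ▸ h.sq_eq_bot, fun b m => ?_, h.injective.comp e.symm.injective, ?_⟩
  · obtain ⟨a, rfl⟩ := hψ.2 a
    obtain ⟨b, rfl⟩ := h.surjective a
    exact ⟨b, hf b⟩
  · obtain ⟨m, rfl⟩ := e.surjective m
    rw [← he]
    simp [h.map_smul]
  · rw [hk, ← h.range_eq]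
    exact e.symm.surjective.range_comp α

/-- A torsor over the zero ring is the zero ring. -/
lemma IsTorsor.subsingleton [Subsingleton A] {τ : Fib M f →+* B} (h : IsTorsor f τ) :
    Subsingleton B := by
  have : Subsingleton M := Module.subsingleton A M
  refine ⟨fun b b' => ?_⟩
  obtain ⟨m, hm, -⟩ := h.existsUnique b b' (Subsingleton.elim _ _)
  rw [← hm, Subsingleton.elim m 0, h.zero_act]

end Rings

/-! ### From stalks to sections -/

section Sheaves

variable {T : TopCat.{u}} {N : T.Presheaf Ab.{u}} {B : T.Presheaf CommRingCat.{u}}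
    (α : ∀ U : (Opens T)ᵒᵖ, N.obj U →+ B.obj U)
    (hα : ∀ (U V : (Opens T)ᵒᵖ) (i : U ⟶ V) (n : N.obj U), α V (N.map i n) = B.map i (α U n))

lemma injective_of_stalkAddHom (hN : N.IsSheaf)
    (hinj : ∀ y, Function.Injective (stalkAddHom α hα y)) (U : (Opens T)ᵒᵖ) :
    Function.Injective (α U) := by
  intro n n' h
  refine TopCat.Presheaf.section_ext ⟨N, hN⟩ U.unop _ _ fun y hy => hinj y ?_
  exact (stalkAddHom_germ α hα y U.unop hy n).trans
    ((congrArg _ h).trans (stalkAddHom_germ α hα y U.unop hy n').symm)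

/-- If `α : N → B` is injective on stalks, then a section of `B` whose germs lie in the image
of `α` lies in the image of `α`: the local preimages are unique, so they glue. -/
lemma exists_eq_of_stalkAddHom (hN : N.IsSheaf) (hB : B.IsSheaf)
    (hinj : ∀ y, Function.Injective (stalkAddHom α hα y)) (U : Opens T) (s : B.obj (op U))
    (hs : ∀ (y : T) (hy : y ∈ U), B.germ U y hy s ∈ Set.range (stalkAddHom α hα y)) :
    ∃ n, α (op U) n = s := by
  have hloc (y : U) : ∃ (V : Opens T) (_ : y.1 ∈ V) (i : V ⟶ U) (n : N.obj (op V)),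
      α (op V) n = B.map i.op s := by
    obtain ⟨t, ht⟩ := hs y.1 y.2
    obtain ⟨W, hW, n, rfl⟩ := N.exists_germ_eq t
    rw [stalkAddHom_germ] at ht
    obtain ⟨V, hV, i, j, h⟩ := B.germ_eq y.1 hW y.2 _ _ ht
    exact ⟨V, hV, j, N.map i.op n, (hα _ _ i.op n).trans h⟩
  choose V hV i n hn using hloc
  have hcover : U ≤ iSup V := fun y hy => Opens.mem_iSup.2 ⟨⟨y, hy⟩, hV ⟨y, hy⟩⟩
  obtain ⟨m, hm, -⟩ := TopCat.Sheaf.existsUnique_gluing' ⟨N, hN⟩ V U i hcover n fun x y => by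
    refine injective_of_stalkAddHom α hα hN hinj _ ?_
    refine (hα _ _ _ _).trans (Eq.trans ?_ (hα _ _ _ _).symm)
    rw [hn, hn, ← ConcreteCategory.comp_apply, ← ConcreteCategory.comp_apply, ← Functor.map_comp,
      ← Functor.map_comp]
    rfl
  refine ⟨m, TopCat.Sheaf.eq_of_locally_eq' ⟨B, hB⟩ V U i hcover _ _ fun y => ?_⟩
  exact (hα _ _ _ _).symm.trans ((congrArg _ (hm y)).trans (hn y))

end Sheaves

/-! ### Kernels of morphisms of modules -/

section Modules

variable {Y : Scheme.{u}} {N P Q : Y.Modules}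

/-- The morphism of `𝒪_Y`-modules with given components on sections. -/
def moduleHomMk (φ : ∀ U : Y.Opens, Γ(N, U) →+ Γ(P, U))
    (hφ : ∀ (U V : Y.Opens) (i : V ⟶ U) (n : Γ(N, U)),
      φ V (N.presheaf.map i.op n) = P.presheaf.map i.op (φ U n))
    (hsmul : ∀ (U : Y.Opens) (b : Γ(Y, U)) (n : Γ(N, U)), φ U (b • n) = b • φ U n) : N ⟶ P :=
  ⟨PresheafOfModules.homMk (M₁ := N.val) (M₂ := P.val)
    { app := fun U => AddCommGrpCat.ofHom (φ U.unop)
      naturality := fun U V i => AddCommGrpCat.hom_ext <| AddMonoidHom.ext fun n =>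
        hφ U.unop V.unop i.unop n }
    fun U => hsmul U.unop⟩

/-- A morphism of modules which is, on the sections over each open subset, the inclusion of the kernel
of `b` is a kernel of `b`. -/
lemma isIso_kernel_lift (a : N ⟶ P) (b : P ⟶ Q) (hab : a ≫ b = 0)
    (hinj : ∀ U, Function.Injective (a.app U))
    (hex : ∀ U (s : Γ(P, U)), b.app U s = 0 → ∃ n, a.app U n = s) :
    IsIso (Limits.kernel.lift b a hab) := by
  rw [Scheme.Modules.Hom.isIso_iff_isIso_app]
  intro U
  have hl (n) : (Limits.kernel.ι b).app U ((Limits.kernel.lift b a hab).app U n) = a.app U n :=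
    ConcreteCategory.congr_hom
      (congrArg (fun φ => Scheme.Modules.Hom.app φ U) (Limits.kernel.lift_ι b a hab)) n
  have hι : Function.Injective ((Limits.kernel.ι b).app U) := by
    have : Mono ((Scheme.Modules.toPresheaf Y).map (Limits.kernel.ι b)) := inferInstance
    have := (NatTrans.mono_iff_mono_app _).1 this (op U)
    exact (AddCommGrpCat.mono_iff_injective _).1 this
  rw [ConcreteCategory.isIso_iff_bijective]
  refine ⟨fun n n' h => hinj U ?_, fun t => ?_⟩
  · rw [← hl, ← hl, h]
  · obtain ⟨n, hn⟩ := hex U ((Limits.kernel.ι b).app U t) (ConcreteCategory.congr_hom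
      (congrArg (fun φ => Scheme.Modules.Hom.app φ U) (Limits.kernel.condition b)) t)
    exact ⟨n, hι ((hl n).trans hn)⟩

end Modules

/-! ### Stalks of direct images under a closed immersion -/

section Stalks

variable {X Y : Scheme.{u}} (f : X ⟶ Y) [IsClosedImmersion f] (M : X.Modules)

/-- The identification `(f_* M)_{f(x)} ≅ M_x` is compatible with the actions of `𝒪_{Y,f(x)}`. -/
lemma stalkPushEquiv_smul (x : X) (b : Y.presheaf.stalk (f x))
    (n : (absh (pushM f M)).stalk (f x)) :
    stalkPushEquiv f M x (stalkRingHom f.c (f x) b • n) =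
      (f.stalkMap x).hom b • stalkPushEquiv f M x n := by
  obtain ⟨U, hU, n, rfl⟩ := (absh (pushM f M)).exists_germ_eq n
  obtain ⟨V, hV, b, rfl⟩ := Y.presheaf.exists_germ_eq b
  rw [← TopCat.Presheaf.germ_res_apply (absh (pushM f M)) (homOfLE inf_le_left : U ⊓ V ⟶ U)
      (f x) ⟨hU, hV⟩ n,
    ← TopCat.Presheaf.germ_res_apply Y.presheaf (homOfLE inf_le_right : U ⊓ V ⟶ V)
      (f x) ⟨hU, hV⟩ b]
  generalize (absh (pushM f M)).map (homOfLE inf_le_left : U ⊓ V ⟶ U).op n = n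
  generalize Y.presheaf.map (homOfLE inf_le_right : U ⊓ V ⟶ V).op b = b
  have h1 : stalkRingHom f.c (f x) (Y.presheaf.germ (U ⊓ V) (f x) ⟨hU, hV⟩ b) =
    (pushO f).germ (U ⊓ V) (f x) ⟨hU, hV⟩ (f.c.app (op (U ⊓ V)) b) := stalkRingHom_germ _ _ _ _ _
  have h2 : (f.stalkMap x).hom (Y.presheaf.germ (U ⊓ V) (f x) ⟨hU, hV⟩ b) =
    X.presheaf.germ (f ⁻¹ᵁ (U ⊓ V)) x ⟨hU, hV⟩ (f.app (U ⊓ V) b) :=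
    f.germ_stalkMap_apply (U ⊓ V) x ⟨hU, hV⟩ b
  have h3 := stalkPushEquiv_germ f M x (U ⊓ V) ⟨hU, hV⟩ n
  rw [h1, h2, h3]
  refine (congrArg _ (presheaf_germ_smul (pushO f) (pushM f M) (f x) (U ⊓ V) ⟨hU, hV⟩ _ n).symm).trans ?_
  refine (stalkPushEquiv_germ f M x (U ⊓ V) ⟨hU, hV⟩ _).trans ?_
  exact presheaf_germ_smul X.presheaf (preMod M) x (f ⁻¹ᵁ (U ⊓ V)) ⟨hU, hV⟩ _ _

/-- At a point outside the image of `f`, the stalk of `f_* 𝒪_X` is the zero ring. -/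
lemma subsingleton_stalk_pushO (y : Y) (hy : y ∉ Set.range f) :
    Subsingleton ((pushO f).stalk y) := by
  let U : Y.Opens := ⟨(Set.range f)ᶜ, f.isClosedEmbedding.isClosed_range.isOpen_compl⟩
  have hU : f ⁻¹ᵁ U = ⊥ := by
    ext x
    simp [U]
  have : Subsingleton Γ(X, f ⁻¹ᵁ U) := by
    rw [hU]
    infer_instance
  rw [← subsingleton_iff_zero_eq_one]
  have h : (0 : (pushO f).obj (op U)) = 1 := Subsingleton.elim (α := Γ(X, f ⁻¹ᵁ U)) _ _
  have := congrArg ((pushO f).germ U y hy) h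
  rwa [map_zero, map_one] at this

end Stalks

/-! ### The thickening defined by a cotorsor -/

/-- The morphism of presheafed spaces with given components. -/
abbrev homOver (Y Z : Scheme.{u}) (b : Y.carrier ⟶ Z.carrier)
    (c : Z.presheaf ⟶ b _* Y.presheaf) : Y.toPresheafedSpace.Hom Z.toPresheafedSpace :=
  PresheafedSpace.Hom.mk b c

/-- On germs, the stalk map `τ^#_{f,y}` is given by the morphism of sheaves `c` underlying `τ`. -/
lemma stalkτ_germ {X Y : Scheme.{u}} {f : X ⟶ Y} [IsClosedImmersion f] {M : X.Modules}
    [M.IsQuasicoherent] (τ : Y ⟶ pushoutScheme f M) (hτ : ∀ y, τ y = jY f M y)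
    (c : (pushoutExtension f M).R ⟶ Y.presheaf)
    (hc : τ.toLRSHom.toHom = homOver Y (pushoutScheme f M) (𝟙 _) c) (y : Y) (U : Opens Y)
    (hy : y ∈ U) (p : Fib ((absh (pushM f M)).obj (op U)) (f.c.app (op U)).hom) :
    stalkτ τ hτ y (Fib.mk _ ((absh (pushM f M)).germ U y hy p.m)
      (Y.presheaf.germ U y hy p.b)) = Y.presheaf.germ U y hy (c.app (op U) p) := by
  obtain ⟨⟨F, h⟩⟩ := τ
  obtain rfl : F = homOver Y (pushoutScheme f M) (𝟙 _) c := hc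
  have h2 : fibStalkEquiv (pushO f) Y.presheaf (pushM f M) f.c y
      ((fibPresheaf (pushO f) Y.presheaf (pushM f M) f.c).germ U y hy p) = Fib.mk _ _ _ :=
    fibStalkHom_germ (pushO f) Y.presheaf (pushM f M) f.c y U hy p
  rw [← h2]
  let τ : Y ⟶ pushoutScheme f M := ⟨⟨homOver Y (pushoutScheme f M) (𝟙 _) c, h⟩⟩
  refine (congrArg (fun t => (τ.stalkMap y).hom
    (((pushoutScheme f M).presheaf.stalkSpecializes (specializes_of_eq (hτ y))).hom t))
    (RingEquiv.symm_apply_apply _ _)).trans ?_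
  refine (congrArg (τ.stalkMap y).hom (TopCat.Presheaf.germ_stalkSpecializes_apply
    (pushoutScheme f M).presheaf (U := U) hy (specializes_of_eq (hτ y)) p)).trans ?_
  exact τ.germ_stalkMap_apply U y hy p

namespace Cotorsor

variable {X : Scheme.{u}} {M : X.Modules} [M.IsQuasicoherent] (C : Cotorsor X M)

/-- At a point outside the image of `f`, the local ring `𝒪_{Y,y}` would be a torsor over the zero
ring, hence itself zero. -/
instance : Surjective C.f := by
  refine ⟨fun y => ?_⟩
  by_contra hy
  have := subsingleton_stalk_pushO C.f y hy
  have := (C.isTorsor y).subsingleton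
  exact not_subsingleton (C.Y.presheaf.stalk y) this

lemma exists_sharp : ∃ c : (pushoutExtension C.f M).R ⟶ C.Y.presheaf,
    C.τ.toLRSHom.toHom = homOver C.Y (pushoutScheme C.f M) (𝟙 _) c := by
  obtain ⟨Y, f, τ, -, hτ, -⟩ := C
  obtain ⟨⟨⟨b, c⟩, h⟩⟩ := τ
  have hb : b = 𝟙 _ := TopCat.hom_ext (ContinuousMap.ext hτ)
  subst hb
  exact ⟨c, rfl⟩

/-- The morphism of sheaves `τ^# : (f_* 𝒪_X ⊕ f_* M) ×_{f_* 𝒪_X} 𝒪_Y → 𝒪_Y` underlying `τ`,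
which is the identity on spaces. -/
def sharp : (pushoutExtension C.f M).R ⟶ C.Y.presheaf := C.exists_sharp.choose

lemma toHom_τ : C.τ.toLRSHom.toHom = homOver C.Y (pushoutScheme C.f M) (𝟙 _) C.sharp :=
  C.exists_sharp.choose_spec

/-- The component of `τ^#` over an open subset. -/
def sharpApp (U : (Opens C.Y)ᵒᵖ) :
    Fib ((absh (pushM C.f M)).obj U) (C.f.c.app U).hom →+* C.Y.presheaf.obj U :=
  (C.sharp.app U).hom

lemma germ_sharpApp (y : C.Y) (U : Opens C.Y) (hy : y ∈ U)
    (p : Fib ((absh (pushM C.f M)).obj (op U)) (C.f.c.app (op U)).hom) :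
    C.Y.presheaf.germ U y hy (C.sharpApp (op U) p) =
      stalkτ C.τ C.τ_eq y (Fib.mk _ ((absh (pushM C.f M)).germ U y hy p.m)
        (C.Y.presheaf.germ U y hy p.b)) :=
  (stalkτ_germ C.τ C.τ_eq C.sharp C.toHom_τ y U hy p).symm

/-- On sections, `τ^#(0, b) = b`, because this holds on stalks. -/
lemma sharpApp_zero (U : (Opens C.Y)ᵒᵖ) (b : C.Y.presheaf.obj U) :
    C.sharpApp U (Fib.mk _ (0 : (absh (pushM C.f M)).obj U) b) = b := by
  refine TopCat.Presheaf.section_ext C.Y.sheaf U.unop _ _ fun y hy => ?_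
  refine (C.germ_sharpApp y U.unop hy _).trans ?_
  rw [Fib.m_mk, map_zero]
  exact (C.isTorsor y).zero_act _

/-- `τ` is a morphism of schemes under `X`, which amounts to `f^#(τ^#(m, b)) = f^#(b)`. -/
lemma f_sharpApp (U : (Opens C.Y)ᵒᵖ)
    (p : Fib ((absh (pushM C.f M)).obj U) (C.f.c.app U).hom) :
    C.f.c.app U (C.sharpApp U p) = C.f.c.app U p.b := by
  let k : (pushoutExtension C.f M).R ⟶ pushO C.f := C.sharp ≫ C.f.c
  have h1 : (C.f ≫ C.τ).toLRSHom.toHom =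
      homOver X (pushoutScheme C.f M) C.f.base k := by
    have h (F) (hF : F = homOver C.Y (pushoutScheme C.f M) (𝟙 _) C.sharp) :
        PresheafedSpace.comp C.f.toLRSHom.toHom F = homOver X (pushoutScheme C.f M) C.f.base k := by
      subst hF
      rfl
    exact h _ C.toHom_τ
  have h := c_eq_of_eq C.comm C.f.base k
    ((pushoutExtension C.f M).π ≫ C.f.c) h1 rfl
  exact ConcreteCategory.congr_hom (NatTrans.congr_app h U) p

/-- The map `f_* M → 𝒪_Y` on sections, given by `m ↦ τ^#(m, 0)`. -/
def αApp (U : (Opens C.Y)ᵒᵖ) : (absh (pushM C.f M)).obj U →+ C.Y.presheaf.obj U :=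
  Fib.actZero (C.sharpApp U)

lemma αApp_map (U V : (Opens C.Y)ᵒᵖ) (i : U ⟶ V) (m : (absh (pushM C.f M)).obj U) :
    C.αApp V ((absh (pushM C.f M)).map i m) = C.Y.presheaf.map i (C.αApp U m) := by
  refine Eq.trans ?_ (ConcreteCategory.congr_hom (C.sharp.naturality i) (Fib.mk _ m 0))
  exact congrArg (C.sharpApp V) (Fib.ext' rfl (map_zero (C.Y.presheaf.map i).hom).symm)

lemma stalkAddHom_αApp (y : C.Y) (n : (absh (pushM C.f M)).stalk y) :
    stalkAddHom C.αApp C.αApp_map y n = Fib.actZero (stalkτ C.τ C.τ_eq y) n := by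
  obtain ⟨U, hU, n, rfl⟩ := (absh (pushM C.f M)).exists_germ_eq n
  rw [stalkAddHom_germ]
  refine (C.germ_sharpApp y U hU _).trans ?_
  rw [Fib.b_mk, map_zero]
  rfl

/-- The morphism `f_* M ⟶ 𝒪_Y` of `𝒪_Y`-modules, given by `m ↦ τ^#(m, 0)`. -/
def αι : (Scheme.Modules.pushforward C.f).obj M ⟶ unitMod C.Y :=
  moduleHomMk (N := (Scheme.Modules.pushforward C.f).obj M) (P := unitMod C.Y)
    (fun U => C.αApp (op U)) (fun _ _ i n => C.αApp_map _ _ i.op n)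
    (fun U b n => Fib.actZero_smul (C.sharpApp_zero (op U)) b n)

lemma αι_sharp : C.αι ≫ SqZeroThickening.sharp C.f = 0 := by
  ext U m
  exact (C.f_sharpApp (op U) (Fib.mk _ m 0)).trans (map_zero _)

lemma stalkAddHom_αApp_injective (y : C.Y) :
    Function.Injective (stalkAddHom C.αApp C.αApp_map y) := by
  convert (C.isTorsor y).isSquareZeroExtension.injective using 1
  exact funext (C.stalkAddHom_αApp y)

lemma αApp_injective (U : (Opens C.Y)ᵒᵖ) : Function.Injective (C.αApp U) :=
  injective_of_stalkAddHom C.αApp C.αApp_map ((Scheme.Modules.pushforward C.f).obj M).isSheaf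
    C.stalkAddHom_αApp_injective U

lemma exists_αApp_eq (U : Opens C.Y) (s : Γ(C.Y, U)) (hs : C.f.app U s = 0) :
    ∃ m, C.αApp (op U) m = s := by
  refine exists_eq_of_stalkAddHom C.αApp C.αApp_map
    ((Scheme.Modules.pushforward C.f).obj M).isSheaf C.Y.IsSheaf C.stalkAddHom_αApp_injective
    U s fun y hy => ?_
  have h : C.Y.presheaf.germ U y hy s ∈ RingHom.ker (stalkRingHom C.f.c y) := by
    rw [RingHom.mem_ker, stalkRingHom_germ]
    exact (congrArg _ hs).trans (map_zero _)
  obtain ⟨n, hn⟩ := (C.isTorsor y).isSquareZeroExtension.range_eq.symm.subset h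
  exact ⟨n, (C.stalkAddHom_αApp y n).trans hn⟩

/-- The isomorphism `α : f_* M ≅ I_f` given by `m ↦ τ^#(m, 0)`. -/
def α : (Scheme.Modules.pushforward C.f).obj M ≅ idealSheaf C.f :=
  @asIso _ _ _ _ (Limits.kernel.lift (SqZeroThickening.sharp C.f) C.αι C.αι_sharp)
    (isIso_kernel_lift _ _ _ (fun U => C.αApp_injective (op U)) C.exists_αApp_eq)

lemma sectionMap_α : sectionMap C.α.hom = C.αApp := by
  have h : C.α.hom ≫ idealι C.f = C.αι :=
    Limits.kernel.lift_ι (SqZeroThickening.sharp C.f) C.αι C.αι_sharp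
  funext U
  unfold sectionMap
  rw [h]
  rfl

lemma stalkα_α (x : X) : stalkα C.α.hom x = (Fib.actZero (stalkτ C.τ C.τ_eq (C.f x))).comp
    (stalkPushEquiv C.f M x).symm.toAddMonoidHom := by
  have h (α) (hα) (e : α = C.αApp) : stalkAddHom α hα (C.f x) =
      Fib.actZero (stalkτ C.τ C.τ_eq (C.f x)) := by
    subst e
    exact AddMonoidHom.ext (C.stalkAddHom_αApp (C.f x))
  exact congrArg (AddMonoidHom.comp · _) (h _ _ C.sectionMap_α)

/-- The first order thickening defined by a cotorsor: `f`, together with `α(m) = τ^#(m, 0)`. -/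
def toThickening : FirstOrderThickening X M where
  Y := C.Y
  f := C.f
  α := C.α
  isSquareZeroExtension x := by
    have : IsIso (TopCat.Presheaf.stalkPushforward CommRingCat.{u} C.f.base X.presheaf x) :=
      TopCat.Presheaf.stalkPushforward.stalkPushforward_iso_of_isInducing CommRingCat.{u}
        C.f.isClosedEmbedding.isInducing _ x
    rw [stalkα_α]
    exact (C.isTorsor (C.f x)).isSquareZeroExtension.of_equiv _
      (TopCat.Presheaf.stalkPushforward CommRingCat.{u} C.f.base X.presheaf x).hom
      (ConcreteCategory.bijective_of_isIso _) (fun _ => rfl) _ (stalkPushEquiv_smul C.f M x)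

/-- The two morphisms agree because `τ^#(m, b) = τ^#(m, 0) + τ^#(0, b) = α(m) + b`. -/
lemma tau_toThickening : C.toThickening.tau = C.τ := by
  refine scheme_hom_ext _ _ (𝟙 _) C.toThickening.tauSharp C.sharp rfl C.toHom_τ ?_
  refine NatTrans.ext <| funext fun (U : (Opens C.Y)ᵒᵖ) => CommRingCat.hom_ext <| RingHom.ext
    fun (p : Fib ((absh (pushM C.f M)).obj U) (C.f.c.app U).hom) => ?_
  refine Eq.trans ?_ (Fib.eq_actZero_add (C.sharpApp_zero U) p).symm
  change sectionMap C.α.hom U p.m + p.b = C.αApp U p.m + p.b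
  exact congrArg (· + p.b) (DFunLike.congr_fun (congrFun C.sectionMap_α U) p.m)

lemma Phi_obj_toThickening : (Phi X M).obj C.toThickening = C := by
  have h := C.tau_toThickening
  obtain ⟨Y, f, τ, _, _, _⟩ := C
  dsimp [Phi]
  congr 1

end Cotorsor

/-! ### The functor is an equivalence -/

instance (X : Scheme.{u}) (M : X.Modules) [M.IsQuasicoherent] : (Phi X M).Faithful where
  map_injective h := FirstOrderThickening.Hom.ext (congrArg Cotorsor.Hom.h h)

instance (X : Scheme.{u}) (M : X.Modules) [M.IsQuasicoherent] : (Phi X M).Full where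
  map_surjective {S T} a := by
    obtain ⟨h, comm, hact⟩ := a
    change S.Y ⟶ T.Y at h
    change S.f ≫ h = T.f at comm
    refine ⟨⟨h, comm, fun x m => ?_⟩, rfl⟩
    -- The identity `h^#(τ(m, c)) = τ(m, h^#(c))` for `c = 0`.
    have h' : stalkUnder h comm x (act T.tau T.tau_eq x m 0) =
      act S.tau S.tau_eq x m (stalkUnder h comm x 0) := hact x m 0
    rwa [T.act_tau, S.act_tau, add_zero, map_zero, add_zero] at h'

instance (X : Scheme.{u}) (M : X.Modules) [M.IsQuasicoherent] : (Phi X M).EssSurj where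
  mem_essImage C := ⟨C.toThickening, ⟨eqToIso C.Phi_obj_toThickening⟩⟩

end

end SqZeroThickening

theorem mainTheorem2 (X : Scheme.{u}) (M : X.Modules) [M.IsQuasicoherent] :
    (SqZeroThickening.Phi X M).IsEquivalence where
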